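/- Let $n\ge 1$, $0<\alpha\le 1$, and let $\mathbb R^n_+=\{x\in\mathbb R^n: x_1,\dots,x_n\ge 0\}$. For $p,x\in\mathbb R^n_+$ put $p\odot_\alpha x=\big((p_1x_1)^\alpha+\dots+(p_nx_n)^\alpha\big)^{1/\alpha}$. For a measurable function $a:\mathbb R^n_+\to\mathbb R$, for $p\in\mathbb R^n_+$, $p\ne 0$, and $p_0>0$ put $$\Pi_\alpha[a](p,p_0)=\int_{\mathbb R^n_+}\max(0,\,p_0-p\odot_\alpha x)\,a(x)\,dx,\qquad R_\alpha[a](p,p_0)=\frac{\partial}{\partial p_0}\int_{p\odot_\alpha x\le p_0}a(x)\,dx,$$ the derivative being taken in the sense of distributions on $(0,\infty)$. Let $B(z_1,\dots,z_m)=\Gamma(z_1)\cdots\Gamma(z_m)/\Gamma(z_1+\dots+z_m)$. For $c=(c_1,\dots,c_n)\in\mathbb R^n$ with $c_1<1,\dots,c_n<1$, for $R>0$ and $u_1,\dots,u_n>0$ let $$K_{\alpha,R}(u;c)=\frac{\alpha^{2n-1}}{(2\pi i)^n}\int_{c+i\mathbf B^n(0,R)}\frac{u_1^{-\alpha(z_1-1)-1}\cdots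 u_n^{-\alpha(z_n-1)-1}\,dz}{B(1-z_1,\dots,1-z_n)\,B\big(2,\alpha(n-z_1-\dots-z_n)\big)},$$ where $\mathbf B^n(0,R)$ is the Euclidean ball of radius $R$ in $\mathbb R^n$ centred at the origin. The inversion kernel is $K_\alpha=\lim_{R\to\infty}K_{\alpha,R}$, understood as follows: for real-valued functions $g$ and $a$ on $\mathbb R^n_+$ the formula $$a(x)=\int_{\mathbb R^n_+}K_\alpha(p_1x_1,\dots,p_nx_n;c)\,g(p)\,dp$$ means that for all $R>0$ and all $x$ with $x_1,\dots,x_n>0$ the integral $\int_{\mathbb R^n_+}K_{\alpha,R}(p_1x_1,\dots,p_nx_n;c)\,g(p)\,dp$ converges absolutely, and that these functions of $x$ converge to $a$ as $R\to\infty$ in $L^2\big(\mathbb R^n_+,\prod_k x_k^{2\alpha(c_k-1)+1}\,dx\big)$. Theorem (inversion formula). Let $c_1<1,\dots,c_n<1$ be real and let $a$ be a real-valued measurable function with $$\int_{\mathbb R^n_+}|a(x)|\prod_{k}x_k^{\alpha(c_k-1)}\,dx<\infty,\qquad \int_{\mathbb R^n_+}|a(x)|^2\prod_{k}x_k^{2\alpha(c_k-1)+1}\,dx<\infty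 .$$ Then for all $p$ with $p_1,\dots,p_n>0$ and all $p_0>0$ the integrals in the definitions of $\Pi_\alpha[a]$ and $R_\alpha[a]$ converge absolutely, the distribution $R_\alpha[a](p,\cdot)$ is a locally integrable function on $(0,\infty)$, for almost every $p\in\mathbb R^n_+$ it is integrable on $(0,1]$, and, in the sense above, $$a(x)=\int_{\mathbb R^n_+}K_\alpha(p_1x_1,\dots,p_nx_n;c)\,\Pi_\alpha[a](p,1)\,dp,$$ $$a(x)=\int_{\mathbb R^n_+}K_\alpha(p_1x_1,\dots,p_nx_n;c)\int_0^1\!\int_0^t R_\alpha[a](p,s)\,ds\,dt\,dp .$$ -/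

import Mathlib

open MeasureTheory Filter Topology
open scoped Distributions LineDeriv

noncomputable section

namespace CESRadon

/-- The closed positive orthant of `ℝⁿ`. -/
def orthant (n : ℕ) : Set (Fin n → ℝ) := {x | ∀ k, 0 ≤ x k}

/-- The open positive orthant of `ℝⁿ`. -/
def posOrthant (n : ℕ) : Set (Fin n → ℝ) := {x | ∀ k, 0 < x k}

/-- The operation `a ⊕ b = (a ^ α + b ^ α) ^ (1 / α)` on nonnegative numbers. -/
def cesAdd (α a b : ℝ) : ℝ := (a ^ α + b ^ α) ^ (1 / α)

/-- The CES function `p ⊙ x = p₁ x₁ ⊕ ⋯ ⊕ pₙ xₙ`, in closed form. -/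
def cesProd {n : ℕ} (α : ℝ) (p x : Fin n → ℝ) : ℝ :=
  (∑ k, (p k * x k) ^ α) ^ (1 / α)

/-- On nonnegative vectors the closed form is the iterated sum `p₁ x₁ ⊕ (p₂ x₂ ⊕ ⋯)`. -/
theorem cesProd_succ {n : ℕ} {α : ℝ} (hα : 0 < α) {p x : Fin (n + 1) → ℝ}
    (hp : p ∈ orthant (n + 1)) (hx : x ∈ orthant (n + 1)) :
    cesProd α p x = cesAdd α (p 0 * x 0) (cesProd α (Fin.tail p) (Fin.tail x)) := by
  have h : 0 ≤ ∑ k, (Fin.tail p k * Fin.tail x k) ^ α :=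
    Finset.sum_nonneg fun k _ => Real.rpow_nonneg (mul_nonneg (hp _) (hx _)) _
  simp only [cesProd, cesAdd, Fin.sum_univ_succ]
  rw [← Real.rpow_mul h, one_div_mul_cancel hα.ne', Real.rpow_one]
  rfl

/-- The class of (Lebesgue) measurable functions on the orthant whose `q`-th power is integrable
with weight `ρ`. -/
def MemWeightedL {n : ℕ} (q : ℕ) (ρ a : (Fin n → ℝ) → ℝ) : Prop :=
  AEMeasurable a (volume.restrict (orthant n)) ∧
    ∫⁻ x in orthant n, ‖a x‖ₑ ^ q * ENNReal.ofReal (ρ x) < ⊤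

/-- The weight `∏ xₖ ^ (α (cₖ - 1))`. -/
def weightOne {n : ℕ} (α : ℝ) (c x : Fin n → ℝ) : ℝ := ∏ k, x k ^ (α * (c k - 1))

/-- The weight `∏ xₖ ^ (2 α (cₖ - 1) + 1)`. -/
def weightTwo {n : ℕ} (α : ℝ) (c x : Fin n → ℝ) : ℝ := ∏ k, x k ^ (2 * α * (c k - 1) + 1)

/-- The profit transform `Π_α[a](p, p₀)` of the measure with density `a` on the orthant. -/
def profit {n : ℕ} (α : ℝ) (a : (Fin n → ℝ) → ℝ) (p : Fin n → ℝ) (p₀ : ℝ) : ℝ :=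
  ∫ x in orthant n, max 0 (p₀ - cesProd α p x) * a x

/-- The open half-line `(0, ∞)`. -/
def halfLine : TopologicalSpace.Opens ℝ := ⟨Set.Ioi 0, isOpen_Ioi⟩

/-- The distribution `φ ↦ ∫ f φ` on `(0, ∞)` defined by a locally integrable function `f`. -/
def regularDistribution (f : ℝ → ℝ) : 𝓓'(halfLine, ℝ) :=
  (TestFunction.integralAgainstBilinCLM (ContinuousLinearMap.mul ℝ ℝ) volume f :
    𝓓(halfLine, ℝ) →L[ℝ] ℝ)

/-- The generalized Radon transform `R_α[a](p, ·)` of the measure with density `a` on the orthant: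
the distributional derivative on `(0, ∞)` of `p₀ ↦ ∫_{p ⊙ x ≤ p₀} a(x) dx`. -/
def radon {n : ℕ} (α : ℝ) (a : (Fin n → ℝ) → ℝ) (p : Fin n → ℝ) : 𝓓'(halfLine, ℝ) :=
  ∂_{(1 : ℝ)} (regularDistribution fun p₀ => ∫ x in {x ∈ orthant n | cesProd α p x ≤ p₀}, a x)

/-- The distribution `T` on `(0, ∞)` is the locally integrable function `r`. -/
def IsGivenBy (T : 𝓓'(halfLine, ℝ)) (r : ℝ → ℝ) : Prop :=
  LocallyIntegrableOn r (Set.Ioi 0) ∧ regularDistribution r = T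

/-- The multivariate beta function `∏ Γ(zₖ) / Γ(∑ zₖ)`. -/
def multiBeta {m : ℕ} (z : Fin m → ℂ) : ℂ :=
  (∏ k, Complex.Gamma (z k)) / Complex.Gamma (∑ k, z k)

/-- The integral of `f(z) dz₁ ⋯ dzₙ` over the set `c + i Bⁿ(0, R)`, parametrized by
`zₖ = cₖ + i τₖ`, `τ` in the Euclidean ball. -/
def verticalBallIntegral {n : ℕ} (c : Fin n → ℝ) (R : ℝ) (f : (Fin n → ℂ) → ℂ) : ℂ :=
  Complex.I ^ n * ∫ τ in Metric.ball (0 : EuclideanSpace ℝ (Fin n)) R,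
    f fun k => (c k : ℂ) + Complex.I * (τ k : ℂ)

/-- The truncation `K_{α,R}(u; c)` at radius `R` of the inversion kernel `K_α(u; c)`. -/
def truncKernel {n : ℕ} (α : ℝ) (c : Fin n → ℝ) (R : ℝ) (u : Fin n → ℝ) : ℂ :=
  (α : ℂ) ^ (2 * (n : ℤ) - 1) / (2 * Real.pi * Complex.I) ^ n *
    verticalBallIntegral c R fun z =>
      (∏ k, (u k : ℂ) ^ (-(α : ℂ) * (z k - 1) - 1)) /
        (multiBeta (fun k => 1 - z k) * multiBeta ![2, (α : ℂ) * (n - ∑ k, z k)])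

/-- `∫ K_{α,R}(p₁ x₁, …, pₙ xₙ; c) g(p) dp` over the orthant. -/
def truncInverse {n : ℕ} (α : ℝ) (c : Fin n → ℝ) (R : ℝ) (g : (Fin n → ℝ) → ℝ)
    (x : Fin n → ℝ) : ℂ :=
  ∫ p in orthant n, truncKernel α c R (fun k => p k * x k) * (g p : ℂ)

/-- The formula `a(x) = ∫ K_α(p₁ x₁, …, pₙ xₙ; c) g(p) dp`, where `K_α = lim K_{α,R}` as
`R → ∞`. The truncated kernels do not converge pointwise, so the limit is that of the integrals
against `K_{α,R}` (which have to converge absolutely), in the weighted space `L²` on the orthant,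
exactly as for the inversion integral of the Fourier transform of an `L²` function. -/
def KernelFormula {n : ℕ} (α : ℝ) (c : Fin n → ℝ) (g a : (Fin n → ℝ) → ℝ) : Prop :=
  (∀ R : ℝ, ∀ x ∈ posOrthant n, IntegrableOn
    (fun p => truncKernel α c R (fun k => p k * x k) * (g p : ℂ)) (orthant n)) ∧
  Tendsto (fun R : ℝ => ∫⁻ x in orthant n,
    ‖truncInverse α c R g x - (a x : ℂ)‖ₑ ^ 2 * ENNReal.ofReal (weightTwo α c x))
    atTop (𝓝 0)

end CESRadon

end

/-! In logarithmic coordinates `x = exp t`, `p = exp q`, the quantity `p ⊙ x` depends only on `q +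
t`. After weighting, `p ↦ Π(p, 1)` therefore becomes a correlation `h(q) = ∫ k(q + t) f(t) dt`
(`logProfit_eq`). Here `k` is the weighted function `max 0 (1 - ‖u‖)`, with `‖u‖ = (∑ uₖ ^ α) ^ (1 /
α)`, and `f` is the weighted density. The two hypotheses on `a` say exactly that `f` lies in `L¹`
and in `L²`.

The Fourier transform turns the correlation into a product (`integral_phase_mul_logProfit`). The
transform of `k` is explicit (`integral_cesIntegrand_max`): up to a power of `α` it is the product
of beta functions in the denominator of `K_{α,R}`. This follows from a trick of Dirichlet. The
integral of `φ(‖u‖) ∏ uₖ ^ sₖ` is proportional to the Mellin transform of `φ`, with a factor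
independent of `φ`, and this factor is found by testing `φ(u) = exp(-u ^ α)`, for which the integral
splits into Gamma integrals. The product of beta functions has no zeros on the plane of integration.

Integrating `h` against `K_{α,R}` thus divides out the transform of `k` and leaves the Fourier
inversion integral of `f` over a ball (`truncInverse_profit_expVec`), which tends to `f` in `L²` by
Plancherel.

For the Radon transform, the mass of the sublevel sets of `p ⊙ x` is absolutely continuous in the
level, because `x ↦ p ⊙ x` pulls null sets back to null sets (`exists_density`). Its density is the
Radon transform, and two integrations recover `Π(p, 1)`, which reduces the second formula to the
first. -/

namespace CESRadon

open FourierTransform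

/-! ### Fourier inversion in `L²` by integrals over balls -/

section FourierL2

variable {E : Type*} [NormedAddCommGroup E] [InnerProductSpace ℝ E] [FiniteDimensional ℝ E]
  [MeasurableSpace E] [BorelSpace E]

theorem continuous_fourier_of_integrable {f : E → ℂ} (hf : Integrable f) : Continuous (𝓕 f) :=
  VectorFourier.fourierIntegral_continuous Real.continuous_fourierChar
    (by exact continuous_inner) hf

theorem continuous_fourierInv_of_integrable {f : E → ℂ} (hf : Integrable f) :
    Continuous (𝓕⁻ f) := by
  have : 𝓕⁻ f = fun x => 𝓕 f (-x) := funext fun x => Real.fourierInv_eq_fourier_neg f x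
  rw [this]
  exact (continuous_fourier_of_integrable hf).comp continuous_neg

theorem integral_fourier_mul {f g : E → ℂ} (hf : Integrable f) (hg : Integrable g) :
    ∫ x, 𝓕 f x * g x = ∫ x, f x * 𝓕 g x := by
  have h := VectorFourier.integral_fourierIntegral_smul_eq_flip (μ := volume) (ν := volume)
    (L := innerₗ E) Real.continuous_fourierChar continuous_inner hf hg
  rw [flip_innerₗ] at h
  exact h

theorem integral_fourierInv_mul {f g : E → ℂ} (hf : Integrable f) (hg : Integrable g) :
    ∫ x, 𝓕⁻ f x * g x = ∫ x, f x * 𝓕⁻ g x := by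
  have h := integral_fourier_mul hf hg.comp_neg
  have h' : ∀ x, 𝓕⁻ f x = 𝓕 f (-x) := fun x => Real.fourierInv_eq_fourier_neg f x
  have h'' : ∀ x, 𝓕⁻ g x = 𝓕 (fun y => g (-y)) x := fun x => by
    rw [Real.fourierInv_eq_fourier_comp_neg]
  simp only [h', h'']
  rw [← h, ← integral_neg_eq_self]
  simp

/-- A continuous function and an `L²` function which agree as tempered distributions agree almost
everywhere. -/
theorem ae_eq_of_forall_integral_schwartz {u v : E → ℂ} (hu : Continuous u) (hv : MemLp v 2)
    (h : ∀ g : SchwartzMap E ℂ, ∫ x, g x * u x = ∫ x, g x * v x) : u =ᵐ[volume] v := by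
  have hv' := hv.locallyIntegrable (by norm_num)
  have key := ae_eq_zero_of_integral_contDiff_smul_eq_zero (hu.locallyIntegrable.sub hv') (by
    intro g hg hgc
    have hg₁ : HasCompactSupport (Complex.ofRealCLM ∘ g) := hgc.comp_left rfl
    have hg₂ : ContDiff ℝ (⊤ : ℕ∞) (Complex.ofRealCLM ∘ g) := by fun_prop
    have hh := h (hg₁.toSchwartzMap hg₂)
    have e1 : Integrable (fun x => g x • u x) :=
      hu.locallyIntegrable.integrable_smul_left_of_hasCompactSupport hg.continuous hgc
    have e2 : Integrable (fun x => g x • v x) :=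
      hv'.integrable_smul_left_of_hasCompactSupport hg.continuous hgc
    simp only [Pi.sub_apply, smul_sub]
    rw [integral_sub e1 e2, sub_eq_zero]
    simpa using hh)
  filter_upwards [key] with x hx
  simpa [sub_eq_zero] using hx

/-- The transform on `L²` is compatible with that of tempered distributions, and the multiplication
formula shows that the Fourier integral defines the same distribution. -/
theorem coeFn_fourier_toLp {f : E → ℂ} (hf : Integrable f) (hf₂ : MemLp f 2) :
    (𝓕 (hf₂.toLp f) : Lp ℂ 2 (volume : Measure E)) =ᵐ[volume] 𝓕 f := by
  refine (ae_eq_of_forall_integral_schwartz (continuous_fourier_of_integrable hf)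
    (Lp.memLp _) fun g => ?_).symm
  have h1 := congrArg (fun T => T g) (Lp.fourier_toTemperedDistribution_eq (hf₂.toLp f))
  simp only [TemperedDistribution.fourier_apply, Lp.toTemperedDistribution_apply,
    smul_eq_mul] at h1
  rw [← h1]
  have h2 := integral_fourier_mul g.integrable hf
  rw [← h2]
  refine integral_congr_ae ?_
  filter_upwards [hf₂.coeFn_toLp] with x hx
  rw [hx, SchwartzMap.fourier_coe]

theorem coeFn_fourierInv_toLp {f : E → ℂ} (hf : Integrable f) (hf₂ : MemLp f 2) :
    (𝓕⁻ (hf₂.toLp f) : Lp ℂ 2 (volume : Measure E)) =ᵐ[volume] 𝓕⁻ f := by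
  refine (ae_eq_of_forall_integral_schwartz (continuous_fourierInv_of_integrable hf)
    (Lp.memLp _) fun g => ?_).symm
  have h1 := congrArg (fun T => T g) (Lp.fourierInv_toTemperedDistribution_eq (hf₂.toLp f))
  simp only [TemperedDistribution.fourierInv_apply, Lp.toTemperedDistribution_apply,
    smul_eq_mul] at h1
  rw [← h1]
  have h2 := integral_fourierInv_mul g.integrable hf
  rw [← h2]
  refine integral_congr_ae ?_
  filter_upwards [hf₂.coeFn_toLp] with x hx
  rw [hx, SchwartzMap.fourierInv_coe]

/-- Truncations of an `L²` function to balls of growing radius converge to it in `L²`. -/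
theorem tendsto_eLpNorm_indicator_ball_sub {g : E → ℂ} (hg : MemLp g 2) :
    Tendsto (fun R : ℝ => eLpNorm ((Metric.ball (0 : E) R).indicator g - g) 2) atTop (𝓝 0) := by
  have h2 : (2 : ENNReal) ≠ 0 := by norm_num
  have h2' : (2 : ENNReal) ≠ ⊤ := by norm_num
  have hfin : ∫⁻ x, ‖g x‖ₑ ^ (2 : ℝ) ≠ ⊤ := by
    have := lintegral_rpow_enorm_lt_top_of_eLpNorm_lt_top h2 h2' hg.eLpNorm_lt_top
    simpa using this.ne
  have hlim : Tendsto (fun R : ℝ => ∫⁻ x, ‖((Metric.ball (0 : E) R).indicator g - g) x‖ₑ ^ (2 : ℝ))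
      atTop (𝓝 (∫⁻ _ : E, 0)) := by
    refine tendsto_lintegral_filter_of_dominated_convergence' (fun x => ‖g x‖ₑ ^ (2 : ℝ)) ?_ ?_
      hfin ?_
    · refine Eventually.of_forall fun R => ?_
      exact (((hg.1.indicator measurableSet_ball).sub hg.1).enorm.pow_const 2)
    · refine Eventually.of_forall fun R => Eventually.of_forall fun x => ?_
      by_cases hx : x ∈ Metric.ball (0 : E) R <;> simp [hx]
    · refine Eventually.of_forall fun x => ?_
      refine tendsto_const_nhds.congr' ?_
      filter_upwards [eventually_gt_atTop ‖x‖] with R hR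
      have : x ∈ Metric.ball (0 : E) R := by simpa using hR
      simp [this]
  simp only [lintegral_zero] at hlim
  have := hlim.ennrpow_const (1 / 2)
  simp only [eLpNorm_eq_lintegral_rpow_enorm_toReal h2 h2', ENNReal.toReal_ofNat]
  simpa using this

/-- The Fourier inversion integrals over balls of an `L¹ ∩ L²` function converge to it in `L²`. -/
theorem tendsto_eLpNorm_fourierInv_indicator_fourier_sub {f : E → ℂ} (hf : Integrable f)
    (hf₂ : MemLp f 2) :
    Tendsto (fun R : ℝ => eLpNorm (𝓕⁻ ((Metric.ball (0 : E) R).indicator (𝓕 f)) - f) 2)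
      atTop (𝓝 0) := by
  set F : Lp ℂ 2 (volume : Measure E) := 𝓕 (hf₂.toLp f)
  have hF : F =ᵐ[volume] 𝓕 f := coeFn_fourier_toLp hf hf₂
  have hFm : MemLp (𝓕 f) 2 := (memLp_congr_ae hF).1 (Lp.memLp F)
  -- By Plancherel the inversion error equals, for each `R`, the truncation error of `𝓕 f`.
  refine (tendsto_eLpNorm_indicator_ball_sub hFm).congr fun R => ?_
  have hc := continuous_fourier_of_integrable hf
  have hi : Integrable ((Metric.ball (0 : E) R).indicator (𝓕 f)) :=
    (integrable_indicator_iff measurableSet_ball).2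
      ((hc.continuousOn.integrableOn_compact (isCompact_closedBall 0 R)).mono_set
        Metric.ball_subset_closedBall)
  have hi₂ : MemLp ((Metric.ball (0 : E) R).indicator (𝓕 f)) 2 := hFm.indicator measurableSet_ball
  have e1 : F = hFm.toLp _ := by
    apply Lp.ext
    exact hF.trans hFm.coeFn_toLp.symm
  have e2 : (𝓕⁻ (hi₂.toLp _ - hFm.toLp _) : Lp ℂ 2 (volume : Measure E)) =ᵐ[volume]
      𝓕⁻ ((Metric.ball (0 : E) R).indicator (𝓕 f)) - f := by
    have : (𝓕⁻ (hi₂.toLp _ - hFm.toLp _) : Lp ℂ 2 (volume : Measure E)) =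
        𝓕⁻ (hi₂.toLp _) - hf₂.toLp f := by
      have h1 := (Lp.fourierTransformₗᵢ E ℂ).symm.map_sub (hi₂.toLp _) (hFm.toLp _)
      have h2 : (Lp.fourierTransformₗᵢ E ℂ).symm (hFm.toLp _) = hf₂.toLp f := by
        rw [← e1]
        exact (Lp.fourierTransformₗᵢ E ℂ).symm_apply_apply _
      rw [h2] at h1
      exact h1
    rw [this]
    filter_upwards [Lp.coeFn_sub (𝓕⁻ (hi₂.toLp _)) (hf₂.toLp f), coeFn_fourierInv_toLp hi hi₂,
      hf₂.coeFn_toLp] with x h1 h2 h3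
    rw [h1, Pi.sub_apply, Pi.sub_apply, h2, h3]
  rw [← eLpNorm_congr_ae e2, ← eLpNorm_congr_ae ((Lp.coeFn_sub _ _).trans
    (hi₂.coeFn_toLp.sub hFm.coeFn_toLp))]
  have h3 : ‖(𝓕⁻ (hi₂.toLp _ - hFm.toLp _) : Lp ℂ 2 (volume : Measure E))‖ =
      ‖hi₂.toLp _ - hFm.toLp _‖ := (Lp.fourierTransformₗᵢ E ℂ).symm.norm_map _
  rw [Lp.norm_def, Lp.norm_def] at h3
  exact ((ENNReal.toReal_eq_toReal_iff' (Lp.eLpNorm_ne_top _) (Lp.eLpNorm_ne_top _)).1 h3).symm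

end FourierL2

end CESRadon

namespace CESRadon

/-! ### Logarithmic coordinates on the orthant -/

section LogCoordinates

variable {n : ℕ}

/-- The componentwise exponential, a parametrization of the open orthant. -/
noncomputable def expVec {n : ℕ} (t : Fin n → ℝ) : Fin n → ℝ := fun k => Real.exp (t k)

theorem expVec_mem (t : Fin n → ℝ) : expVec t ∈ posOrthant n := fun _ => Real.exp_pos _

theorem expVec_injective : Function.Injective (expVec (n := n)) := fun _ _ h =>
  funext fun k => Real.exp_injective (congrFun h k)

theorem expVec_add (s t : Fin n → ℝ) : expVec (s + t) = fun k => expVec s k * expVec t k :=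
  funext fun _ => Real.exp_add _ _

theorem exists_expVec_eq {x : Fin n → ℝ} (hx : x ∈ posOrthant n) : ∃ t, expVec t = x :=
  ⟨fun k => Real.log (x k), funext fun k => Real.exp_log (hx k)⟩

theorem image_expVec : expVec '' Set.univ = posOrthant n := by
  ext x
  constructor
  · rintro ⟨t, -, rfl⟩
    exact expVec_mem t
  · intro hx
    obtain ⟨t, rfl⟩ := exists_expVec_eq hx
    exact ⟨t, trivial, rfl⟩

theorem continuous_expVec : Continuous (expVec (n := n)) := by
  unfold expVec
  fun_prop

theorem measurableSet_orthant : MeasurableSet (orthant n) := by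
  simp only [orthant, Set.ofPred_forall]
  exact MeasurableSet.iInter fun k => measurableSet_le measurable_const (measurable_pi_apply k)

theorem measurableSet_posOrthant : MeasurableSet (posOrthant n) := by
  simp only [posOrthant, Set.ofPred_forall]
  exact MeasurableSet.iInter fun k => measurableSet_lt measurable_const (measurable_pi_apply k)

theorem posOrthant_subset : posOrthant n ⊆ orthant n := fun _ hx k => (hx k).le

/-- The difference lies in the coordinate hyperplanes, which are null. Logarithmic coordinates reach
only the open orthant, so this is what lets them compute integrals over the closed one. -/
theorem posOrthant_ae_eq : posOrthant n =ᵐ[volume] orthant n := by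
  have h : ∀ᵐ x : Fin n → ℝ, ∀ k, x k ≠ 0 := by
    rw [ae_all_iff]
    exact fun k => Measure.ae_eval_ne _ k 0
  filter_upwards [h] with x hx
  refine propext ⟨fun h => posOrthant_subset h, fun h k => ?_⟩
  exact lt_of_le_of_ne (h k) (hx k).symm

theorem restrict_orthant : volume.restrict (orthant n) = volume.restrict (posOrthant n) :=
  (Measure.restrict_congr_set posOrthant_ae_eq).symm

theorem hasFDerivWithinAt_expVec (t : Fin n → ℝ) (s : Set (Fin n → ℝ)) :
    HasFDerivWithinAt expVec
      (ContinuousLinearMap.pi fun k =>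
        (ContinuousLinearMap.toSpanSingleton ℝ (Real.exp (t k))).comp
          (ContinuousLinearMap.proj k)) s t := by
  rw [hasFDerivWithinAt_pi']
  intro k
  have h := ((Real.hasDerivAt_exp (t k)).hasFDerivAt.comp t
    (ContinuousLinearMap.proj (R := ℝ) (φ := fun _ : Fin n => ℝ) k).hasFDerivAt).hasFDerivWithinAt
    (s := s)
  exact h

theorem abs_det_expVec (t : Fin n → ℝ) :
    |(ContinuousLinearMap.pi fun k =>
        (ContinuousLinearMap.toSpanSingleton ℝ (Real.exp (t k))).comp
          (ContinuousLinearMap.proj (R := ℝ) (φ := fun _ : Fin n => ℝ) k)).det|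
      = Real.exp (∑ k, t k) := by
  rw [ContinuousLinearMap.det_pi, Real.exp_sum, abs_of_nonneg]
  · exact Finset.prod_congr rfl fun k _ => by simp [ContinuousLinearMap.det]
  · exact Finset.prod_nonneg fun k _ => by
      simp [ContinuousLinearMap.det, (Real.exp_pos _).le]

theorem lintegral_orthant (g : (Fin n → ℝ) → ENNReal) :
    ∫⁻ x in orthant n, g x = ∫⁻ t, ENNReal.ofReal (Real.exp (∑ k, t k)) * g (expVec t) := by
  rw [restrict_orthant, ← image_expVec,
    lintegral_image_eq_lintegral_abs_det_fderiv_mul volume MeasurableSet.univ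
      (fun t _ => hasFDerivWithinAt_expVec t _) expVec_injective.injOn]
  simp only [abs_det_expVec, Measure.restrict_univ]

theorem integral_orthant {F : Type*} [NormedAddCommGroup F] [NormedSpace ℝ F]
    (g : (Fin n → ℝ) → F) :
    ∫ x in orthant n, g x = ∫ t, Real.exp (∑ k, t k) • g (expVec t) := by
  rw [restrict_orthant, ← image_expVec,
    integral_image_eq_integral_abs_det_fderiv_smul volume MeasurableSet.univ
      (fun t _ => hasFDerivWithinAt_expVec t _) expVec_injective.injOn]
  simp only [abs_det_expVec, Measure.restrict_univ]

theorem integrableOn_orthant_iff {F : Type*} [NormedAddCommGroup F] [NormedSpace ℝ F]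
    (g : (Fin n → ℝ) → F) :
    IntegrableOn g (orthant n) ↔ Integrable fun t => Real.exp (∑ k, t k) • g (expVec t) := by
  rw [IntegrableOn, restrict_orthant, ← image_expVec, ← IntegrableOn,
    integrableOn_image_iff_integrableOn_abs_det_fderiv_smul volume MeasurableSet.univ
      (fun t _ => hasFDerivWithinAt_expVec t _) expVec_injective.injOn]
  simp only [abs_det_expVec, integrableOn_univ]

theorem expVec_rpow_prod (t s : Fin n → ℝ) :
    ∏ k, expVec t k ^ s k = Real.exp (∑ k, s k * t k) := by
  rw [Real.exp_sum]
  exact Finset.prod_congr rfl fun k _ => by rw [expVec, ← Real.exp_mul, mul_comm]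

end LogCoordinates

end CESRadon

namespace CESRadon

/-! ### Mellin transforms of functions of the CES norm -/

section Dirichlet

variable {n : ℕ}

/-- The CES norm of the vector with logarithms `t`. -/
noncomputable def cesExp {n : ℕ} (α : ℝ) (t : Fin n → ℝ) : ℝ :=
  (∑ k, Real.exp (α * t k)) ^ (1 / α)

theorem cesProd_expVec (α : ℝ) (s t : Fin n → ℝ) :
    cesProd α (expVec s) (expVec t) = cesExp α (s + t) := by
  simp only [cesProd, cesExp, expVec, ← Real.exp_add, ← Real.exp_mul, Pi.add_apply, mul_comm]

theorem cesExp_pos [NeZero n] (α : ℝ) (t : Fin n → ℝ) : 0 < cesExp α t :=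
  Real.rpow_pos_of_pos (Finset.sum_pos (fun _ _ => Real.exp_pos _) Finset.univ_nonempty) _

theorem cesExp_rpow {α : ℝ} (hα : α ≠ 0) (t : Fin n → ℝ) :
    cesExp α t ^ α = ∑ k, Real.exp (α * t k) := by
  rw [cesExp, ← Real.rpow_mul (Finset.sum_nonneg fun _ _ => (Real.exp_pos _).le),
    one_div_mul_cancel hα, Real.rpow_one]

theorem continuous_cesExp [NeZero n] (α : ℝ) : Continuous (cesExp (n := n) α) := by
  unfold cesExp
  refine Continuous.rpow_const (by fun_prop) fun t => Or.inl ?_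
  exact (Finset.sum_pos (fun _ _ => Real.exp_pos _) Finset.univ_nonempty).ne'

/-- Homogeneity of degree one, written additively: translating all logarithms by `-r` scales the CES
norm by `exp (-r)`. -/
theorem cesExp_sub_const {α : ℝ} (hα : α ≠ 0) (t : Fin n → ℝ) (r : ℝ) :
    cesExp α (t - fun _ => r) = Real.exp (-r) * cesExp α t := by
  have h : ∑ k, Real.exp (α * (t k - r)) =
      Real.exp (-(α * r)) * ∑ k, Real.exp (α * t k) := by
    rw [Finset.mul_sum]
    exact Finset.sum_congr rfl fun k _ => by
      rw [← Real.exp_add]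
      congr 1
      ring
  simp only [cesExp, Pi.sub_apply]
  rw [h, Real.mul_rpow (Real.exp_pos _).le
    (Finset.sum_nonneg fun _ _ => (Real.exp_pos _).le), ← Real.exp_mul]
  congr 2
  field_simp

/-- The integrand `φ (‖u‖) ∏ uₖ ^ sₖ` of a multiplicative integral over the orthant, `‖ ‖` the CES
norm, in logarithmic coordinates. -/
noncomputable def cesIntegrand {n : ℕ} (α : ℝ) (s : Fin n → ℂ) (φ : ℝ → ℂ) (t : Fin n → ℝ) : ℂ :=
  φ (cesExp α t) * Complex.exp (∑ k, s k * t k)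

/-- The integrand `φ (u) u ^ S` of a Mellin transform, in the logarithmic coordinate. -/
noncomputable def mellinIntegrand (S : ℂ) (φ : ℝ → ℂ) (r : ℝ) : ℂ :=
  φ (Real.exp r) * Complex.exp (S * r)

theorem continuous_cesIntegrand [NeZero n] (α : ℝ) (s : Fin n → ℂ) {φ : ℝ → ℂ}
    (hφ : Continuous φ) : Continuous (cesIntegrand α s φ) := by
  have := continuous_cesExp (n := n) α
  unfold cesIntegrand
  fun_prop

/-- Translating `t` by `r` in every coordinate pulls `exp (-r)` out of the norm and splits the
monomial, the total exponent `∑ sₖ` going to the Mellin integrand. The right-hand side is almost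
symmetric in `φ` and `ψ`. -/
theorem integral_cesIntegrand_mul_integral_mellinIntegrand [NeZero n] {α : ℝ} (hα : α ≠ 0)
    (s : Fin n → ℂ) {φ ψ : ℝ → ℂ} (hφ : Continuous φ) (hψ : Continuous ψ)
    (hJ : Integrable (cesIntegrand α s φ)) (hM : Integrable (mellinIntegrand (∑ k, s k) ψ)) :
    (∫ t, cesIntegrand α s φ t) * ∫ r, mellinIntegrand (∑ k, s k) ψ r =
      ∫ t : Fin n → ℝ, ∫ r : ℝ, φ (Real.exp (-r) * cesExp α t) * ψ (Real.exp r) *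
        Complex.exp (∑ k, s k * t k) := by
  have key : ∀ (r : ℝ) (t : Fin n → ℝ), φ (Real.exp (-r) * cesExp α t) * ψ (Real.exp r) *
      Complex.exp (∑ k, s k * t k) =
      cesIntegrand α s φ (t - fun _ => r) * mellinIntegrand (∑ k, s k) ψ r := by
    intro r t
    have : Complex.exp (∑ k, s k * t k) =
        Complex.exp (∑ k, s k * ((t k - r : ℝ) : ℂ)) * Complex.exp ((∑ k, s k) * r) := by
      rw [← Complex.exp_add, Finset.sum_mul, ← Finset.sum_add_distrib]
      congr 1
      refine Finset.sum_congr rfl fun k _ => ?_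
      push_cast
      ring
    rw [this, cesIntegrand, mellinIntegrand, cesExp_sub_const hα]
    simp only [Pi.sub_apply]
    ring
  have hc := continuous_cesExp (n := n) α
  have hint : Integrable (Function.uncurry fun (r : ℝ) (t : Fin n → ℝ) =>
      φ (Real.exp (-r) * cesExp α t) * ψ (Real.exp r) * Complex.exp (∑ k, s k * t k))
      (volume.prod volume) := by
    rw [integrable_prod_iff (Continuous.aestronglyMeasurable
      (by unfold Function.uncurry; fun_prop))]
    simp only [Function.uncurry_apply_pair, key, norm_mul]
    constructor
    · exact Eventually.of_forall fun r => (hJ.comp_sub_right _).mul_const _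
    · simp only [integral_mul_const]
      refine (hM.norm.const_mul (∫ t, ‖cesIntegrand α s φ t‖)).congr
        (Eventually.of_forall fun r => ?_)
      beta_reduce
      rw [integral_sub_right_eq_self fun t => ‖cesIntegrand α s φ t‖]
  rw [← integral_integral_swap hint]
  simp only [key, integral_mul_const]
  rw [← integral_const_mul]
  refine integral_congr_ae (Eventually.of_forall fun r => ?_)
  beta_reduce
  rw [integral_sub_right_eq_self (cesIntegrand α s φ)]

/-- Integrals over the orthant of functions of the CES norm against a monomial are proportional to
one-dimensional Mellin transforms. -/
theorem integral_cesIntegrand_mul_comm [NeZero n] {α : ℝ} (hα : α ≠ 0)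
    (s : Fin n → ℂ) {φ ψ : ℝ → ℂ} (hφ : Continuous φ) (hψ : Continuous ψ)
    (hJφ : Integrable (cesIntegrand α s φ)) (hJψ : Integrable (cesIntegrand α s ψ))
    (hMφ : Integrable (mellinIntegrand (∑ k, s k) φ))
    (hMψ : Integrable (mellinIntegrand (∑ k, s k) ψ)) :
    (∫ t, cesIntegrand α s φ t) * ∫ r, mellinIntegrand (∑ k, s k) ψ r =
      (∫ t, cesIntegrand α s ψ t) * ∫ r, mellinIntegrand (∑ k, s k) φ r := by
  rw [integral_cesIntegrand_mul_integral_mellinIntegrand hα s hφ hψ hJφ hMψ,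
    integral_cesIntegrand_mul_integral_mellinIntegrand hα s hψ hφ hJψ hMφ]
  congr 1 with t
  have h := cesExp_pos α t
  -- The reflection `r ↦ log ‖t‖ - r` exchanges `exp (-r) * ‖t‖` and `exp r`, hence `φ` and `ψ`.
  rw [← integral_sub_left_eq_self _ volume (Real.log (cesExp α t))]
  congr 1 with r
  rw [neg_sub, Real.exp_sub, Real.exp_sub, Real.exp_neg, Real.exp_log h,
    div_mul_cancel₀ _ h.ne', ← div_eq_inv_mul]
  ring

/-- The change of variables `u = exp r` in a Mellin transform. -/
theorem integral_mellinIntegrand (S : ℂ) (φ : ℝ → ℂ) :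
    ∫ r, mellinIntegrand S φ r = ∫ u in Set.Ioi (0 : ℝ), (u : ℂ) ^ (S - 1) * φ u := by
  have h := integral_image_eq_integral_abs_deriv_smul MeasurableSet.univ
    (fun x _ => (Real.hasDerivAt_exp x).hasDerivWithinAt) Real.exp_injective.injOn
    (fun u : ℝ => (u : ℂ) ^ (S - 1) * φ u)
  rw [Set.image_univ, Real.range_exp, Measure.restrict_univ] at h
  rw [h]
  congr 1 with r
  rw [mellinIntegrand, abs_of_pos (Real.exp_pos r), Complex.real_smul,
    Complex.cpow_def_of_ne_zero (by exact_mod_cast (Real.exp_pos r).ne'), ← mul_assoc,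
    ← Complex.ofReal_log (Real.exp_pos r).le, Real.log_exp, Complex.ofReal_exp, ← Complex.exp_add,
    mul_comm]
  congr 2
  ring

theorem integrable_mellinIntegrand_iff (S : ℂ) (φ : ℝ → ℂ) :
    Integrable (mellinIntegrand S φ) ↔
      IntegrableOn (fun u : ℝ => (u : ℂ) ^ (S - 1) * φ u) (Set.Ioi 0) := by
  have h := integrableOn_image_iff_integrableOn_abs_deriv_smul MeasurableSet.univ
    (fun x _ => (Real.hasDerivAt_exp x).hasDerivWithinAt) Real.exp_injective.injOn
    (fun u : ℝ => (u : ℂ) ^ (S - 1) * φ u)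
  rw [Set.image_univ, Real.range_exp, integrableOn_univ] at h
  rw [h]
  refine integrable_congr (Eventually.of_forall fun r => ?_)
  beta_reduce
  rw [mellinIntegrand, abs_of_pos (Real.exp_pos r), Complex.real_smul,
    Complex.cpow_def_of_ne_zero (by exact_mod_cast (Real.exp_pos r).ne'), ← mul_assoc,
    ← Complex.ofReal_log (Real.exp_pos r).le, Real.log_exp, Complex.ofReal_exp, ← Complex.exp_add,
    mul_comm]
  congr 2
  ring


theorem integrable_mellinIntegrand_exp {α : ℝ} (hα : 0 < α) {S : ℂ} (hS : 0 < S.re) :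
    Integrable (mellinIntegrand S fun u => (Real.exp (-(u ^ α)) : ℂ)) ∧
    ∫ r, mellinIntegrand S (fun u => (Real.exp (-(u ^ α)) : ℂ)) r = Complex.Gamma (S / α) / α := by
  have hα' : (α : ℂ) ≠ 0 := by exact_mod_cast hα.ne'
  have hS' : 0 < (S / α).re := by
    rw [Complex.div_ofReal_re]
    positivity
  have e : (mellinIntegrand S fun u => (Real.exp (-(u ^ α)) : ℂ)) =
      fun r => mellinIntegrand (S / α) (fun u => (Real.exp (-u) : ℂ)) (α * r) := by
    funext r
    simp only [mellinIntegrand]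
    rw [← Real.exp_mul, mul_comm r α]
    congr 2
    push_cast
    field_simp
  have hi : Integrable (mellinIntegrand (S / α) fun u => (Real.exp (-u) : ℂ)) := by
    rw [integrable_mellinIntegrand_iff]
    exact (Complex.GammaIntegral_convergent hS').congr_fun (fun _ _ => mul_comm _ _)
      measurableSet_Ioi
  rw [e]
  refine ⟨hi.comp_mul_left' hα.ne', ?_⟩
  rw [Measure.integral_comp_mul_left, integral_mellinIntegrand, Complex.Gamma_eq_integral hS',
    Complex.GammaIntegral, abs_of_pos (inv_pos.2 hα), Complex.real_smul, Complex.ofReal_inv,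
    div_eq_inv_mul (∫ _ in _, _ : ℂ) (α : ℂ)]
  congr 2 with u
  exact mul_comm _ _

/-- The power `‖u‖ ^ α` is a sum over coordinates, so this choice of `φ` separates the variables. -/
theorem cesIntegrand_exp {α : ℝ} (hα : α ≠ 0) (s : Fin n → ℂ) :
    cesIntegrand α s (fun u => (Real.exp (-(u ^ α)) : ℂ)) =
      fun t => ∏ k, mellinIntegrand (s k) (fun u => (Real.exp (-(u ^ α)) : ℂ)) (t k) := by
  funext t
  simp only [cesIntegrand, mellinIntegrand, cesExp_rpow hα]
  rw [Finset.prod_mul_distrib, ← Complex.exp_sum, ← Finset.sum_neg_distrib, Real.exp_sum,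
    Complex.ofReal_prod]
  congr 1
  refine Finset.prod_congr rfl fun k _ => ?_
  rw [← Real.exp_mul, mul_comm]

theorem integrable_cesIntegrand_exp {α : ℝ} (hα : 0 < α) {s : Fin n → ℂ} (hs : ∀ k, 0 < (s k).re) :
    Integrable (cesIntegrand α s fun u => (Real.exp (-(u ^ α)) : ℂ)) ∧
    ∫ t, cesIntegrand α s (fun u => (Real.exp (-(u ^ α)) : ℂ)) t =
      ∏ k, (Complex.Gamma (s k / α) / α) := by
  rw [cesIntegrand_exp hα.ne']
  refine ⟨Integrable.fintype_prod fun k => (integrable_mellinIntegrand_exp hα (hs k)).1, ?_⟩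
  rw [integral_fintype_prod_volume_eq_prod
    fun k => mellinIntegrand (s k) fun u => (Real.exp (-(u ^ α)) : ℂ)]
  exact Finset.prod_congr rfl fun k _ => (integrable_mellinIntegrand_exp hα (hs k)).2

/-- The factor `e` makes the right side at least `1` on `[0, 1]`; beyond `1` the left side vanishes.
Integrability thus passes from the exponential to the profit function. -/
theorem max_one_sub_le_exp {α u : ℝ} (hα : 0 < α) (hu : 0 ≤ u) :
    max 0 (1 - u) ≤ Real.exp 1 * Real.exp (-(u ^ α)) := by
  rw [← Real.exp_add]
  refine max_le (Real.exp_pos _).le ?_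
  rcases le_total u 1 with h | h
  · have h1 : u ^ α ≤ 1 := Real.rpow_le_one hu h hα.le
    calc 1 - u ≤ 1 := by linarith
      _ ≤ Real.exp (1 + -(u ^ α)) := Real.one_le_exp (by linarith)
  · exact (by linarith : 1 - u ≤ 0).trans (Real.exp_pos _).le

theorem continuous_exp_neg_rpow {α : ℝ} (hα : 0 < α) :
    Continuous fun u : ℝ => (Real.exp (-(u ^ α)) : ℂ) := by
  have : Continuous fun u : ℝ => u ^ α := Real.continuous_rpow_const hα.le
  fun_prop

theorem continuous_max_one_sub : Continuous fun u : ℝ => ((max 0 (1 - u) : ℝ) : ℂ) := by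
  fun_prop

theorem norm_max_one_sub_le {α u : ℝ} (hα : 0 < α) (hu : 0 ≤ u) :
    ‖((max 0 (1 - u) : ℝ) : ℂ)‖ ≤ Real.exp 1 * ‖(Real.exp (-(u ^ α)) : ℂ)‖ := by
  rw [Complex.norm_of_nonneg (le_max_left _ _), Complex.norm_of_nonneg (Real.exp_pos _).le]
  exact max_one_sub_le_exp hα hu

theorem integrable_cesIntegrand_max [NeZero n] {α : ℝ} (hα : 0 < α) {s : Fin n → ℂ}
    (hs : ∀ k, 0 < (s k).re) :
    Integrable (cesIntegrand α s fun u => ((max 0 (1 - u) : ℝ) : ℂ)) := by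
  refine ((integrable_cesIntegrand_exp hα hs).1.norm.const_mul (Real.exp 1)).mono'
    (continuous_cesIntegrand α s continuous_max_one_sub).aestronglyMeasurable
    (Eventually.of_forall fun t => ?_)
  simp only [cesIntegrand, norm_mul]
  rw [← mul_assoc]
  exact mul_le_mul_of_nonneg_right (norm_max_one_sub_le hα (cesExp_pos α t).le) (norm_nonneg _)

theorem integrable_mellinIntegrand_max {S : ℂ} (hS : 0 < S.re) :
    Integrable (mellinIntegrand S fun u => ((max 0 (1 - u) : ℝ) : ℂ)) := by
  refine ((integrable_mellinIntegrand_exp one_pos hS).1.norm.const_mul (Real.exp 1)).mono'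
    (Continuous.aestronglyMeasurable ?_) (Eventually.of_forall fun r => ?_)
  · unfold mellinIntegrand
    fun_prop
  · simp only [mellinIntegrand, norm_mul]
    rw [← mul_assoc]
    exact mul_le_mul_of_nonneg_right (norm_max_one_sub_le one_pos (Real.exp_pos r).le)
      (norm_nonneg _)

theorem integral_mellinIntegrand_max {S : ℂ} (hS : 0 < S.re) :
    ∫ r, mellinIntegrand S (fun u => ((max 0 (1 - u) : ℝ) : ℂ)) r = multiBeta ![2, S] := by
  have h2 : 0 < (2 : ℂ).re := by norm_num
  have hne : Complex.Gamma (S + 2) ≠ 0 :=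
    Complex.Gamma_ne_zero_of_re_pos (by rw [Complex.add_re]; linarith)
  have hB : multiBeta ![2, S] = Complex.betaIntegral S 2 := by
    rw [multiBeta, Fin.prod_univ_two, Fin.sum_univ_two]
    simp only [Matrix.cons_val_zero, Matrix.cons_val_one]
    rw [mul_comm, Complex.Gamma_mul_Gamma_eq_betaIntegral hS h2, add_comm 2 S,
      mul_div_cancel_left₀ _ hne]
  rw [hB, integral_mellinIntegrand, Complex.betaIntegral,
    intervalIntegral.integral_of_le zero_le_one]
  refine (setIntegral_eq_of_subset_of_forall_sdiff_eq_zero measurableSet_Ioi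
    (Set.Ioc_subset_Ioi_self : Set.Ioc (0 : ℝ) 1 ⊆ Set.Ioi 0) fun u hu => ?_).trans
    (setIntegral_congr_fun measurableSet_Ioc fun u hu => ?_)
  · have : 1 < u := not_le.1 fun h => hu.2 ⟨hu.1, h⟩
    rw [max_eq_left (by linarith)]
    simp
  · rw [max_eq_right (by linarith [hu.2])]
    norm_num

theorem multiBeta_ne_zero {m : ℕ} [NeZero m] {z : Fin m → ℂ} (hz : ∀ k, 0 < (z k).re) :
    multiBeta z ≠ 0 := by
  refine div_ne_zero (Finset.prod_ne_zero_iff.2 fun k _ => Complex.Gamma_ne_zero_of_re_pos (hz k))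
    (Complex.Gamma_ne_zero_of_re_pos ?_)
  rw [Complex.re_sum]
  exact Finset.sum_pos (fun k _ => hz k) Finset.univ_nonempty

/-- The multiplicative Mellin transform of the profit function `max 0 (1 - ‖u‖)`. -/
theorem integral_cesIntegrand_max [NeZero n] {α : ℝ} (hα : 0 < α) {s : Fin n → ℂ}
    (hs : ∀ k, 0 < (s k).re) :
    ∫ t, cesIntegrand α s (fun u => ((max 0 (1 - u) : ℝ) : ℂ)) t =
      (α : ℂ) / α ^ n * (multiBeta (fun k => s k / α) * multiBeta ![2, ∑ k, s k]) := by
  have hα' : (α : ℂ) ≠ 0 := by exact_mod_cast hα.ne'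
  have hS : 0 < (∑ k, s k).re := by
    rw [Complex.re_sum]
    exact Finset.sum_pos (fun k _ => hs k) Finset.univ_nonempty
  -- Comparison with `exp(-u ^ α)`, whose multiple and single integrals are both known; it remains
  -- to divide by `Γ(∑ sₖ / α)`.
  have h := integral_cesIntegrand_mul_comm hα.ne' s continuous_max_one_sub
    (continuous_exp_neg_rpow hα) (integrable_cesIntegrand_max hα hs)
    (integrable_cesIntegrand_exp hα hs).1 (integrable_mellinIntegrand_max hS)
    (integrable_mellinIntegrand_exp hα hS).1
  rw [(integrable_cesIntegrand_exp hα hs).2, (integrable_mellinIntegrand_exp hα hS).2,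
    integral_mellinIntegrand_max hS, Finset.prod_div_distrib, Finset.prod_const,
    Finset.card_univ, Fintype.card_fin] at h
  have hne : Complex.Gamma ((∑ k, s k) / α) ≠ 0 := Complex.Gamma_ne_zero_of_re_pos (by
    rw [Complex.div_ofReal_re]
    positivity)
  rw [multiBeta, ← Finset.sum_div]
  field_simp at h ⊢
  linear_combination h

end Dirichlet

end CESRadon

namespace CESRadon

open FourierTransform

/-! ### Correlations of integrable functions -/

section Correlation

variable {n : ℕ}

/-- The shear `(q, t) ↦ (q + t, t)` preserves the product measure. -/
theorem integrable_correlation_prod {k f : (Fin n → ℝ) → ℂ} (hk : Integrable k)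
    (hf : Integrable f) :
    Integrable (fun z : (Fin n → ℝ) × (Fin n → ℝ) => k (z.1 + z.2) * f z.2)
      (volume.prod volume) := by
  have h := (measurePreserving_add_prod (volume : Measure (Fin n → ℝ))
    (volume : Measure (Fin n → ℝ))).integrable_comp_of_integrable (hk.mul_prod hf)
  refine h.congr (Eventually.of_forall fun z => ?_)
  simp

theorem integrable_correlation {k f : (Fin n → ℝ) → ℂ} (hk : Integrable k) (hf : Integrable f) :
    Integrable fun q => ∫ t, k (q + t) * f t :=
  (integrable_correlation_prod hk hf).integral_prod_left

theorem integral_correlation {k f : (Fin n → ℝ) → ℂ} (hk : Integrable k) (hf : Integrable f) :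
    ∫ q, ∫ t, k (q + t) * f t = (∫ q, k q) * ∫ t, f t := by
  rw [integral_integral_swap (integrable_correlation_prod hk hf), ← integral_const_mul]
  congr 1 with t
  rw [integral_mul_const, integral_add_right_eq_self k t]

end Correlation

/-! ### The weighted spaces in logarithmic coordinates -/

section Weights

variable {n : ℕ}

/-- The density of the measure with density `a`, in logarithmic coordinates and weighted by
`∏ xₖ ^ (α (cₖ - 1))`. -/
noncomputable def logDensity {n : ℕ} (α : ℝ) (c : Fin n → ℝ) (a : (Fin n → ℝ) → ℝ)
    (t : Fin n → ℝ) : ℝ :=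
  Real.exp (∑ k, (1 - α * (1 - c k)) * t k) * a (expVec t)

theorem weightOne_nonneg (α : ℝ) (c : Fin n → ℝ) {x : Fin n → ℝ} (hx : x ∈ orthant n) :
    0 ≤ weightOne α c x :=
  Finset.prod_nonneg fun k _ => Real.rpow_nonneg (hx k) _

theorem integrableOn_mul_weightOne {α : ℝ} {c : Fin n → ℝ} {a : (Fin n → ℝ) → ℝ}
    (ha : MemWeightedL 1 (weightOne α c) a) :
    IntegrableOn (fun x => a x * weightOne α c x) (orthant n) := by
  have hm : Measurable (weightOne α c) := by
    unfold weightOne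
    fun_prop
  refine ⟨(ha.1.mul hm.aemeasurable).aestronglyMeasurable, ?_⟩
  refine lt_of_le_of_lt (le_of_eq ?_) ha.2
  refine setLIntegral_congr_fun measurableSet_orthant fun x hx => ?_
  beta_reduce
  rw [enorm_mul, pow_one, Real.enorm_of_nonneg (weightOne_nonneg α c hx)]

theorem integrable_logDensity {α : ℝ} {c : Fin n → ℝ} {a : (Fin n → ℝ) → ℝ}
    (ha : MemWeightedL 1 (weightOne α c) a) : Integrable (logDensity α c a) := by
  refine ((integrableOn_orthant_iff _).1 (integrableOn_mul_weightOne ha)).congr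
    (Eventually.of_forall fun t => ?_)
  beta_reduce
  rw [weightOne, expVec_rpow_prod t fun k => α * (c k - 1), logDensity, smul_eq_mul, mul_comm (a _),
    ← mul_assoc, ← Real.exp_add, ← Finset.sum_add_distrib]
  congr 2
  exact Finset.sum_congr rfl fun k _ => by ring

/-- The Jacobian adds `1` to the exponent `2 α (cₖ - 1) + 1`, giving twice the exponent of
`logDensity`: the weighted `L²` norm is the plain one in logarithmic coordinates. -/
theorem lintegral_weightTwo (α : ℝ) (c : Fin n → ℝ) (b : (Fin n → ℝ) → ENNReal) :
    ∫⁻ x in orthant n, b x ^ 2 * ENNReal.ofReal (weightTwo α c x) =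
      ∫⁻ t, (ENNReal.ofReal (Real.exp (∑ k, (1 - α * (1 - c k)) * t k)) * b (expVec t)) ^ 2 := by
  rw [lintegral_orthant]
  congr 1 with t
  have e : Real.exp (∑ k, t k) * Real.exp (∑ k, (2 * α * (c k - 1) + 1) * t k) =
      Real.exp (∑ k, (1 - α * (1 - c k)) * t k) ^ 2 := by
    rw [← Real.exp_add, ← Finset.sum_add_distrib, ← Real.exp_nat_mul, Finset.mul_sum]
    congr 1
    refine Finset.sum_congr rfl fun k _ => ?_
    push_cast
    ring
  rw [weightTwo, expVec_rpow_prod t fun k => 2 * α * (c k - 1) + 1, mul_pow,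
    ← ENNReal.ofReal_pow (Real.exp_pos _).le, ← e, ENNReal.ofReal_mul (Real.exp_pos _).le]
  ring

theorem memLp_logDensity {α : ℝ} {c : Fin n → ℝ} {a : (Fin n → ℝ) → ℝ}
    (ha : MemWeightedL 1 (weightOne α c) a) (ha₂ : MemWeightedL 2 (weightTwo α c) a) :
    MemLp (logDensity α c a) 2 := by
  refine ⟨(integrable_logDensity ha).1, ?_⟩
  rw [eLpNorm_lt_top_iff_lintegral_rpow_enorm_lt_top (by norm_num) (by norm_num)]
  have h := ha₂.2
  rw [lintegral_weightTwo] at h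
  refine lt_of_le_of_lt (le_of_eq ?_) h
  congr 1 with t
  rw [logDensity, enorm_mul, Real.enorm_of_nonneg (Real.exp_pos _).le, ENNReal.toReal_ofNat,
    ENNReal.rpow_ofNat]

end Weights

end CESRadon

namespace CESRadon

open FourierTransform

/-! ### The profit transform as a correlation, and the kernel in logarithmic coordinates -/

section Inversion

variable {n : ℕ}

/-- The denominator of the integrand of the inversion kernel on the plane of integration. -/
noncomputable def kernelDenom {n : ℕ} (α : ℝ) (c τ : Fin n → ℝ) : ℂ :=
  multiBeta (fun k => 1 - ((c k : ℂ) + Complex.I * τ k)) *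
    multiBeta ![2, (α : ℂ) * (n - ∑ k, ((c k : ℂ) + Complex.I * τ k))]

/-- The character `u ↦ ∏ uₖ ^ (-i α τₖ)` of the multiplicative group, in logarithmic coordinates. -/
noncomputable def phase {n : ℕ} (α : ℝ) (τ t : Fin n → ℝ) : ℂ :=
  Complex.exp (-(Complex.I * ((α * ∑ k, τ k * t k : ℝ) : ℂ)))

theorem norm_phase (α : ℝ) (τ t : Fin n → ℝ) : ‖phase α τ t‖ = 1 := by
  rw [phase, ← mul_neg, ← Complex.ofReal_neg, mul_comm, Complex.norm_exp_ofReal_mul_I]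

theorem phase_add (α : ℝ) (τ s t : Fin n → ℝ) :
    phase α τ (s + t) = phase α τ s * phase α τ t := by
  rw [phase, phase, phase, ← Complex.exp_add]
  congr 1
  simp only [Pi.add_apply, mul_add, Finset.sum_add_distrib]
  push_cast
  ring

theorem phase_mul_phase_neg (α : ℝ) (τ t : Fin n → ℝ) : phase α τ t * phase α τ (-t) = 1 := by
  rw [← phase_add, add_neg_cancel]
  simp [phase]

theorem continuous_phase (α : ℝ) :
    Continuous fun z : (Fin n → ℝ) × (Fin n → ℝ) => phase α z.1 z.2 := by
  unfold phase
  fun_prop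

theorem continuousAt_Gamma_of_re_pos {s : ℂ} (hs : 0 < s.re) : ContinuousAt Complex.Gamma s :=
  Complex.continuousAt_Gamma s fun m h => by
    rw [h] at hs
    have : (0 : ℝ) ≤ m := Nat.cast_nonneg m
    simp at hs
    linarith

theorem continuous_multiBeta {X : Type*} [TopologicalSpace X] {m : ℕ} [NeZero m]
    {z : X → Fin m → ℂ} (hz : Continuous z) (hpos : ∀ x k, 0 < (z x k).re) :
    Continuous fun x => multiBeta (z x) := by
  have hs : ∀ x, 0 < (∑ k, z x k).re := fun x => by
    rw [Complex.re_sum]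
    exact Finset.sum_pos (fun k _ => hpos x k) Finset.univ_nonempty
  have hk : ∀ k, Continuous fun x => z x k := fun k => (continuous_apply k).comp hz
  refine Continuous.div (continuous_finsetProd _ fun k _ => ?_) ?_
    fun x => Complex.Gamma_ne_zero_of_re_pos (hs x)
  · exact continuous_iff_continuousAt.2 fun x =>
      ContinuousAt.comp (f := fun x => z x k) (continuousAt_Gamma_of_re_pos (hpos x k))
        (hk k).continuousAt
  · exact continuous_iff_continuousAt.2 fun x =>
      ContinuousAt.comp (f := fun x => ∑ k, z x k) (continuousAt_Gamma_of_re_pos (hs x))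
        (continuous_finsetSum _ fun k _ => hk k).continuousAt

theorem re_one_sub_pos {c : Fin n → ℝ} (hc : ∀ k, c k < 1) (τ : Fin n → ℝ) (k : Fin n) :
    0 < (1 - ((c k : ℂ) + Complex.I * τ k)).re := by
  simpa using hc k

theorem re_sum_pos [NeZero n] {α : ℝ} (hα : 0 < α) {c : Fin n → ℝ} (hc : ∀ k, c k < 1)
    (τ : Fin n → ℝ) (j : Fin 2) :
    0 < ((![2, (α : ℂ) * (n - ∑ k, ((c k : ℂ) + Complex.I * τ k))] : Fin 2 → ℂ) j).re := by
  have h : (n : ℂ) - ∑ k, ((c k : ℂ) + Complex.I * τ k) =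
      ∑ k, (1 - ((c k : ℂ) + Complex.I * τ k)) := by
    simp
  fin_cases j
  · simp
  · simp only [Fin.mk_one, Matrix.cons_val_one, Matrix.cons_val_fin_one]
    rw [h, Complex.re_ofReal_mul, Complex.re_sum]
    exact mul_pos hα (Finset.sum_pos (fun k _ => re_one_sub_pos hc τ k) Finset.univ_nonempty)

/-- Since `cₖ < 1`, all arguments of Gamma lie in the right half-plane, where it has neither poles
nor zeros. -/
theorem kernelDenom_ne_zero [NeZero n] {α : ℝ} (hα : 0 < α) {c : Fin n → ℝ} (hc : ∀ k, c k < 1)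
    (τ : Fin n → ℝ) : kernelDenom α c τ ≠ 0 :=
  mul_ne_zero (multiBeta_ne_zero (re_one_sub_pos hc τ)) (multiBeta_ne_zero (re_sum_pos hα hc τ))

theorem continuous_kernelDenom [NeZero n] {α : ℝ} (hα : 0 < α) {c : Fin n → ℝ}
    (hc : ∀ k, c k < 1) : Continuous (kernelDenom α c) := by
  unfold kernelDenom
  refine (continuous_multiBeta (by fun_prop) (re_one_sub_pos hc)).mul
    (continuous_multiBeta ?_ (re_sum_pos hα hc))
  refine continuous_pi fun j => ?_
  fin_cases j
  · exact continuous_const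
  · simp only [Fin.mk_one, Matrix.cons_val_one, Matrix.cons_val_fin_one]
    fun_prop

/-- The truncation matters: the denominator is a multiple of the Fourier transform of an integrable
function, so it tends to `0` at infinity and its reciprocal is integrable only locally. -/
theorem integrableOn_inv_kernelDenom [NeZero n] {α : ℝ} (hα : 0 < α) {c : Fin n → ℝ}
    (hc : ∀ k, c k < 1) (R : ℝ) :
    IntegrableOn (fun τ : EuclideanSpace ℝ (Fin n) => (kernelDenom α c τ.ofLp)⁻¹)
      (Metric.ball 0 R) := by
  have h : Continuous fun τ : EuclideanSpace ℝ (Fin n) => (kernelDenom α c τ.ofLp)⁻¹ :=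
    ((continuous_kernelDenom hα hc).comp (PiLp.continuous_ofLp 2 _)).inv₀
      fun τ => kernelDenom_ne_zero hα hc _
  exact (h.continuousOn.integrableOn_compact (isCompact_closedBall 0 R)).mono_set
    Metric.ball_subset_closedBall

/-- The profit function `max 0 (1 - ‖u‖)` weighted by `∏ uₖ ^ (α (1 - cₖ))`, in logarithmic
coordinates. -/
noncomputable def logProfitKernel {n : ℕ} (α : ℝ) (c : Fin n → ℝ) : (Fin n → ℝ) → ℂ :=
  cesIntegrand α (fun k => ((α * (1 - c k) : ℝ) : ℂ)) fun u => ((max 0 (1 - u) : ℝ) : ℂ)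

theorem integrable_logProfitKernel [NeZero n] {α : ℝ} (hα : 0 < α) {c : Fin n → ℝ}
    (hc : ∀ k, c k < 1) : Integrable (logProfitKernel α c) :=
  integrable_cesIntegrand_max hα fun k => by
    rw [Complex.ofReal_re]
    exact mul_pos hα (by linarith [hc k])

/-- The phase shifts the exponents `α (1 - cₖ)` to `α (1 - zₖ)` with `zₖ = cₖ + i τₖ`. -/
theorem integral_phase_mul_logProfitKernel [NeZero n] {α : ℝ} (hα : 0 < α) {c : Fin n → ℝ}
    (hc : ∀ k, c k < 1) (τ : Fin n → ℝ) :
    ∫ t, phase α τ t * logProfitKernel α c t = (α : ℂ) / α ^ n * kernelDenom α c τ := by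
  have hα' : (α : ℂ) ≠ 0 := by exact_mod_cast hα.ne'
  have h := integral_cesIntegrand_max hα
    (s := fun k => (α : ℂ) * (1 - ((c k : ℂ) + Complex.I * τ k))) fun k => by
      rw [Complex.re_ofReal_mul]
      exact mul_pos hα (re_one_sub_pos hc τ k)
  rw [kernelDenom]
  have e1 : ∑ k, (α : ℂ) * (1 - ((c k : ℂ) + Complex.I * τ k)) =
      (α : ℂ) * (n - ∑ k, ((c k : ℂ) + Complex.I * τ k)) := by
    rw [← Finset.mul_sum]
    simp
  simp only [mul_div_cancel_left₀ _ hα', e1] at h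
  rw [← h]
  congr 1 with t
  rw [phase, logProfitKernel, cesIntegrand, cesIntegrand, mul_left_comm, ← Complex.exp_add]
  congr 2
  push_cast
  rw [Finset.mul_sum, Finset.mul_sum, ← Finset.sum_neg_distrib, ← Finset.sum_add_distrib]
  exact Finset.sum_congr rfl fun k _ => by ring

/-- The profit transform weighted by `∏ pₖ ^ (α (1 - cₖ))`, in logarithmic coordinates. -/
noncomputable def logProfit {n : ℕ} (α : ℝ) (c : Fin n → ℝ) (a : (Fin n → ℝ) → ℝ)
    (q : Fin n → ℝ) : ℂ :=
  ((Real.exp (∑ k, α * (1 - c k) * q k) * profit α a (expVec q) 1 : ℝ) : ℂ)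

theorem logProfit_eq (α : ℝ) (c : Fin n → ℝ) (a : (Fin n → ℝ) → ℝ) (q : Fin n → ℝ) :
    logProfit α c a q = ∫ t, logProfitKernel α c (q + t) * logDensity α c a t := by
  rw [logProfit, profit, integral_orthant, ← integral_const_mul, ← integral_complex_ofReal]
  congr 1 with t
  rw [cesProd_expVec, logProfitKernel, cesIntegrand, logDensity]
  have e : Real.exp (∑ k, α * (1 - c k) * q k) * Real.exp (∑ k, t k) =
      Real.exp (∑ k, α * (1 - c k) * (q + t) k) * Real.exp (∑ k, (1 - α * (1 - c k)) * t k) := by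
    rw [← Real.exp_add, ← Real.exp_add, ← Finset.sum_add_distrib, ← Finset.sum_add_distrib]
    congr 1
    exact Finset.sum_congr rfl fun k _ => by
      rw [Pi.add_apply]
      ring
  rw [smul_eq_mul, ← mul_assoc, e]
  push_cast
  ring

theorem integrable_phase_mul {f : (Fin n → ℝ) → ℂ} (hf : Integrable f) {α : ℝ} {τ : Fin n → ℝ}
    {g : (Fin n → ℝ) → (Fin n → ℝ)} (hg : Continuous g) :
    Integrable fun t => phase α τ (g t) * f t := by
  refine hf.bdd_mul (c := 1) ?_ (Eventually.of_forall fun t => (norm_phase _ _ _).le)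
  exact ((continuous_phase α).comp
    (by fun_prop : Continuous fun t => (τ, g t))).aestronglyMeasurable

/-- The convolution theorem: a character satisfies `phase q = phase (q + t) * phase (-t)`, so the
integral of the correlation factors. -/
theorem integral_phase_mul_logProfit [NeZero n] {α : ℝ} (hα : 0 < α) {c : Fin n → ℝ}
    (hc : ∀ k, c k < 1) {a : (Fin n → ℝ) → ℝ} (ha : MemWeightedL 1 (weightOne α c) a)
    (τ : Fin n → ℝ) :
    ∫ q, phase α τ q * logProfit α c a q =
      (α : ℂ) / α ^ n * kernelDenom α c τ * ∫ t, phase α τ (-t) * logDensity α c a t := by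
  have hf : Integrable fun t => (logDensity α c a t : ℂ) := (integrable_logDensity ha).ofReal
  have hk : Integrable fun t => phase α τ t * logProfitKernel α c t :=
    integrable_phase_mul (integrable_logProfitKernel hα hc) continuous_id
  rw [← integral_phase_mul_logProfitKernel hα hc,
    ← integral_correlation hk (integrable_phase_mul hf continuous_neg)]
  congr 1 with q
  rw [logProfit_eq, ← integral_const_mul]
  congr 1 with t
  rw [phase_add]
  linear_combination (-phase α τ q * logProfitKernel α c (q + t) * logDensity α c a t) *
    phase_mul_phase_neg α τ t

theorem integrable_logProfit [NeZero n] {α : ℝ} (hα : 0 < α) {c : Fin n → ℝ}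
    (hc : ∀ k, c k < 1) {a : (Fin n → ℝ) → ℝ} (ha : MemWeightedL 1 (weightOne α c) a) :
    Integrable (logProfit α c a) := by
  have hf : Integrable fun t => (logDensity α c a t : ℂ) := (integrable_logDensity ha).ofReal
  refine (integrable_correlation (integrable_logProfitKernel hα hc) hf).congr
    (Eventually.of_forall fun q => ?_)
  exact (logProfit_eq α c a q).symm

/-- The constant in front of the inversion kernel. -/
noncomputable def kernelConst (n : ℕ) (α : ℝ) : ℂ := (α : ℂ) ^ (2 * (n : ℤ) - 1) / (2 * Real.pi) ^ n

/-- Powers of `exp tₖ` are exponentials, and the `iⁿ` from `dz` cancels the one in `(2πi)ⁿ`. -/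
theorem truncKernel_expVec (α : ℝ) (c : Fin n → ℝ) (R : ℝ) (t : Fin n → ℝ) :
    truncKernel α c R (expVec t) =
      kernelConst n α * Complex.exp (∑ k, ((α * (1 - c k) - 1) * t k : ℝ)) *
        ∫ τ in Metric.ball (0 : EuclideanSpace ℝ (Fin n)) R,
          (kernelDenom α c τ.ofLp)⁻¹ * phase α τ.ofLp t := by
  have hI : (Complex.I : ℂ) ^ n ≠ 0 := pow_ne_zero _ Complex.I_ne_zero
  have hp : ((2 : ℂ) * Real.pi) ^ n ≠ 0 :=
    pow_ne_zero _ (mul_ne_zero two_ne_zero (by exact_mod_cast Real.pi_ne_zero))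
  have e : ∀ τ : EuclideanSpace ℝ (Fin n),
      ∏ k, (expVec t k : ℂ) ^ (-(α : ℂ) * ((c k : ℂ) + Complex.I * (τ k : ℂ) - 1) - 1) =
        Complex.exp (∑ k, ((α * (1 - c k) - 1) * t k : ℝ)) * phase α τ.ofLp t := by
    intro τ
    rw [phase, ← Complex.exp_add]
    have : ∀ k, (expVec t k : ℂ) ^ (-(α : ℂ) * ((c k : ℂ) + Complex.I * (τ k : ℂ) - 1) - 1) =
        Complex.exp (t k * (-(α : ℂ) * ((c k : ℂ) + Complex.I * (τ k : ℂ) - 1) - 1)) := by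
      intro k
      rw [Complex.cpow_def_of_ne_zero (by exact_mod_cast (expVec_mem t k).ne'),
        ← Complex.ofReal_log (expVec_mem t k).le, expVec, Real.log_exp]
    simp only [this]
    rw [← Complex.exp_sum]
    congr 1
    push_cast
    rw [Finset.mul_sum, Finset.mul_sum, ← Finset.sum_neg_distrib, ← Finset.sum_add_distrib]
    exact Finset.sum_congr rfl fun k _ => by ring
  rw [truncKernel, verticalBallIntegral]
  simp only [e]
  rw [kernelConst, mul_assoc _ (Complex.exp _), ← integral_const_mul (Complex.exp _),
    mul_pow _ Complex.I]
  have : ∀ τ : EuclideanSpace ℝ (Fin n),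
      Complex.exp (∑ k, ((α * (1 - c k) - 1) * t k : ℝ)) * phase α τ.ofLp t /
        (multiBeta (fun k => 1 - ((c k : ℂ) + Complex.I * (τ k : ℂ))) *
          multiBeta ![2, (α : ℂ) * (n - ∑ k, ((c k : ℂ) + Complex.I * (τ k : ℂ)))]) =
      Complex.exp (∑ k, ((α * (1 - c k) - 1) * t k : ℝ)) *
        ((kernelDenom α c τ.ofLp)⁻¹ * phase α τ.ofLp t) := by
    intro τ
    rw [kernelDenom]
    ring
  simp only [this]
  field_simp

end Inversion

end CESRadon

namespace CESRadon

open FourierTransform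

/-! ### Inversion of the profit transform -/

section InversionFormula

variable {n : ℕ}

theorem integrable_kernel_prod [NeZero n] {α : ℝ} (hα : 0 < α) {c : Fin n → ℝ}
    (hc : ∀ k, c k < 1) {a : (Fin n → ℝ) → ℝ} (ha : MemWeightedL 1 (weightOne α c) a) (R : ℝ)
    (y : Fin n → ℝ) :
    Integrable (fun z : EuclideanSpace ℝ (Fin n) × (Fin n → ℝ) =>
      (kernelDenom α c z.1.ofLp)⁻¹ * phase α z.1.ofLp (z.2 + y) * logProfit α c a z.2)
      ((volume.restrict (Metric.ball 0 R)).prod volume) := by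
  have h := (integrableOn_inv_kernelDenom hα hc R).mul_prod (integrable_logProfit hα hc ha)
  refine (h.bdd_mul (c := 1) (f := fun z : EuclideanSpace ℝ (Fin n) × (Fin n → ℝ) =>
    phase α z.1.ofLp (z.2 + y)) ?_ (Eventually.of_forall fun t => (norm_phase _ _ _).le)).congr
    (Eventually.of_forall fun z => by ring)
  exact ((continuous_phase α).comp (by fun_prop : Continuous
    fun z : EuclideanSpace ℝ (Fin n) × (Fin n → ℝ) =>
      (z.1.ofLp, z.2 + y))).aestronglyMeasurable

/-- The Jacobian in `q` raises the kernel's exponent `α (1 - cₖ) - 1` by one, to the weight in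
`logProfit`. -/
theorem exp_smul_truncKernel_mul_profit (α : ℝ) (c : Fin n → ℝ) (a : (Fin n → ℝ) → ℝ) (R : ℝ)
    (y q : Fin n → ℝ) :
    Real.exp (∑ k, q k) • (truncKernel α c R (fun k => expVec q k * expVec y k) *
      (profit α a (expVec q) 1 : ℂ)) =
      kernelConst n α * Complex.exp (∑ k, ((α * (1 - c k) - 1) * y k : ℝ)) *
        ∫ τ in Metric.ball (0 : EuclideanSpace ℝ (Fin n)) R,
          (kernelDenom α c τ.ofLp)⁻¹ * phase α τ.ofLp (q + y) * logProfit α c a q := by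
  have e : Complex.exp (∑ k, q k : ℝ) * Complex.exp (∑ k, ((α * (1 - c k) - 1) * (q + y) k : ℝ)) =
      Complex.exp (∑ k, ((α * (1 - c k) - 1) * y k : ℝ)) *
        Complex.exp (∑ k, (α * (1 - c k) * q k) : ℝ) := by
    rw [← Complex.exp_add, ← Complex.exp_add]
    congr 1
    push_cast [Pi.add_apply]
    rw [← Finset.sum_add_distrib, ← Finset.sum_add_distrib]
    exact Finset.sum_congr rfl fun k _ => by ring
  rw [← expVec_add, truncKernel_expVec, integral_mul_const, logProfit, Complex.real_smul]
  push_cast at e ⊢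
  linear_combination (kernelConst n α * (profit α a (expVec q) 1 : ℂ) *
    ∫ τ in Metric.ball (0 : EuclideanSpace ℝ (Fin n)) R,
      (kernelDenom α c τ.ofLp)⁻¹ * phase α τ.ofLp (q + y)) * e

theorem integrableOn_truncKernel_mul_profit [NeZero n] {α : ℝ} (hα : 0 < α) {c : Fin n → ℝ}
    (hc : ∀ k, c k < 1) {a : (Fin n → ℝ) → ℝ} (ha : MemWeightedL 1 (weightOne α c) a) (R : ℝ)
    {x : Fin n → ℝ} (hx : x ∈ posOrthant n) :
    IntegrableOn (fun p => truncKernel α c R (fun k => p k * x k) * (profit α a p 1 : ℂ))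
      (orthant n) := by
  obtain ⟨y, rfl⟩ := exists_expVec_eq hx
  rw [integrableOn_orthant_iff]
  simp only [exp_smul_truncKernel_mul_profit]
  exact (integrable_kernel_prod hα hc ha R y).integral_prod_right.const_mul _

/-- This explains the power `α ^ (2n - 1)`: together with the factor `α / α ^ n` from the transform
of the profit function it gives the Jacobian of the dilation by `α / (2π)`. -/
theorem kernelConst_mul {α : ℝ} (hα : α ≠ 0) :
    kernelConst n α * ((α : ℂ) / α ^ n) = ((α / (2 * Real.pi) : ℝ) : ℂ) ^ n := by
  have hα' : (α : ℂ) ≠ 0 := by exact_mod_cast hα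
  have h : (α : ℂ) ^ (2 * (n : ℤ) - 1) = (α : ℂ) ^ n * (α : ℂ) ^ n / α := by
    rw [zpow_sub_one₀ hα', two_mul, zpow_add₀ hα', zpow_natCast, div_eq_mul_inv]
  rw [kernelConst, h]
  push_cast
  rw [div_pow]
  field_simp

/-- The density as a function on Euclidean space, in logarithmic coordinates. -/
noncomputable def euclideanDensity {n : ℕ} (α : ℝ) (c : Fin n → ℝ) (a : (Fin n → ℝ) → ℝ)
    (v : EuclideanSpace ℝ (Fin n)) : ℂ :=
  logDensity α c a v.ofLp

/-- The scale `-α / (2π)` matches the Fourier character `exp(-2πi⟨v, ξ⟩)` with the phase `exp(iα⟨τ,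
v⟩)`. -/
theorem fourier_euclideanDensity {α : ℝ} (c : Fin n → ℝ) (a : (Fin n → ℝ) → ℝ)
    (τ : EuclideanSpace ℝ (Fin n)) :
    𝓕 (euclideanDensity α c a) (-(α / (2 * Real.pi)) • τ) =
      ∫ t, phase α τ.ofLp (-t) * logDensity α c a t := by
  rw [Real.fourier_eq', ← (PiLp.volume_preserving_ofLp (Fin n)).integral_comp
    (MeasurableEquiv.toLp 2 (Fin n → ℝ)).symm.measurableEmbedding]
  congr 1 with v
  rw [euclideanDensity, smul_eq_mul, phase]
  congr 2
  rw [inner_smul_right, PiLp.inner_apply]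
  simp only [Pi.neg_apply, RCLike.inner_apply, conj_trivial]
  simp only [mul_neg, Finset.sum_neg_distrib]
  push_cast
  have : (Real.pi : ℂ) ≠ 0 := by exact_mod_cast Real.pi_ne_zero
  field_simp

theorem fourierInv_indicator_ball {α : ℝ} (hα : 0 < α) (R : ℝ)
    (F : EuclideanSpace ℝ (Fin n) → ℂ) (v : EuclideanSpace ℝ (Fin n)) :
    𝓕⁻ ((Metric.ball 0 (α / (2 * Real.pi) * R)).indicator F) v =
      ((α / (2 * Real.pi) : ℝ) : ℂ) ^ n * ∫ τ in Metric.ball (0 : EuclideanSpace ℝ (Fin n)) R,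
        phase α τ.ofLp v.ofLp * F (-(α / (2 * Real.pi)) • τ) := by
  have hρ : 0 < α / (2 * Real.pi) := by positivity
  set ρ := α / (2 * Real.pi) with hρdef
  have h := Measure.integral_comp_smul volume (fun ξ : EuclideanSpace ℝ (Fin n) =>
    Complex.exp (↑(2 * Real.pi * inner ℝ ξ v) * Complex.I) •
      (Metric.ball 0 (ρ * R)).indicator F ξ) (-ρ)
  rw [Real.fourierInv_eq', ← integral_indicator measurableSet_ball]
  rw [finrank_euclideanSpace_fin, abs_inv, abs_pow, abs_neg, abs_of_pos hρ, Complex.real_smul,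
    eq_comm] at h
  push_cast at h
  have hρ' : (ρ : ℂ) ^ n ≠ 0 := pow_ne_zero _ (by exact_mod_cast hρ.ne')
  rw [inv_mul_eq_iff_eq_mul₀ hρ'] at h
  push_cast
  rw [h]
  congr 2 with τ
  have hb : -ρ • τ ∈ Metric.ball (0 : EuclideanSpace ℝ (Fin n)) (ρ * R) ↔
      τ ∈ Metric.ball (0 : EuclideanSpace ℝ (Fin n)) R := by
    rw [mem_ball_zero_iff, mem_ball_zero_iff, norm_smul, norm_neg, Real.norm_of_nonneg hρ.le,
      mul_lt_mul_iff_right₀ hρ]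
  by_cases hτ : τ ∈ Metric.ball (0 : EuclideanSpace ℝ (Fin n)) R
  · rw [Set.indicator_of_mem hτ, Set.indicator_of_mem (hb.2 hτ), smul_eq_mul, phase]
    congr 2
    rw [inner_smul_left, PiLp.inner_apply]
    simp only [RCLike.inner_apply, conj_trivial, hρdef]
    have : (Real.pi : ℂ) ≠ 0 := by exact_mod_cast Real.pi_ne_zero
    simp only [mul_comm (v.ofLp _)]
    push_cast
    field_simp
  · rw [Set.indicator_of_notMem hτ, Set.indicator_of_notMem (fun h => hτ (hb.1 h)), smul_zero]

/-- After Fubini the integral over `q` produces `kernelDenom` times the transform of the density,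
and the denominator of the kernel cancels exactly. -/
theorem truncInverse_profit_expVec [NeZero n] {α : ℝ} (hα : 0 < α) {c : Fin n → ℝ}
    (hc : ∀ k, c k < 1) {a : (Fin n → ℝ) → ℝ} (ha : MemWeightedL 1 (weightOne α c) a) (R : ℝ)
    (v : EuclideanSpace ℝ (Fin n)) :
    (Real.exp (∑ k, (1 - α * (1 - c k)) * v k) : ℂ) *
      truncInverse α c R (fun p => profit α a p 1) (expVec v.ofLp) =
      𝓕⁻ ((Metric.ball 0 (α / (2 * Real.pi) * R)).indicator (𝓕 (euclideanDensity α c a))) v := by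
  have e : (Real.exp (∑ k, (1 - α * (1 - c k)) * v k) : ℂ) *
      Complex.exp (∑ k, ((α * (1 - c k) - 1) * v k : ℝ)) = 1 := by
    rw [Complex.ofReal_exp, ← Complex.exp_add]
    push_cast
    rw [← Finset.sum_add_distrib, Finset.sum_eq_zero fun k _ => by ring, Complex.exp_zero]
  rw [fourierInv_indicator_ball hα, ← kernelConst_mul hα.ne', truncInverse, integral_orthant]
  simp only [exp_smul_truncKernel_mul_profit, fourier_euclideanDensity]
  rw [integral_const_mul, ← integral_integral_swap (integrable_kernel_prod hα hc ha R v.ofLp),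
    mul_assoc (kernelConst n α) (_ / _), ← integral_const_mul (_ / _)]
  have h : ∀ τ : EuclideanSpace ℝ (Fin n),
      ∫ q, (kernelDenom α c τ.ofLp)⁻¹ * phase α τ.ofLp (q + v.ofLp) * logProfit α c a q =
      (α : ℂ) / α ^ n *
        (phase α τ.ofLp v.ofLp * ∫ t, phase α τ.ofLp (-t) * logDensity α c a t) := by
    intro τ
    have h1 : ∀ q, (kernelDenom α c τ.ofLp)⁻¹ * phase α τ.ofLp (q + v.ofLp) * logProfit α c a q =
        (kernelDenom α c τ.ofLp)⁻¹ * phase α τ.ofLp v.ofLp *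
          (phase α τ.ofLp q * logProfit α c a q) := fun q => by
      rw [phase_add]
      ring
    simp only [h1]
    rw [integral_const_mul, integral_phase_mul_logProfit hα hc ha]
    have := kernelDenom_ne_zero hα hc τ.ofLp
    field_simp
  simp only [h]
  rw [mul_assoc (kernelConst n α) (Complex.exp _), mul_left_comm, ← mul_assoc (Real.exp _ : ℂ), e,
    one_mul]

theorem kernelFormula_profit [NeZero n] {α : ℝ} (hα : 0 < α) {c : Fin n → ℝ}
    (hc : ∀ k, c k < 1) {a : (Fin n → ℝ) → ℝ} (ha : MemWeightedL 1 (weightOne α c) a)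
    (ha₂ : MemWeightedL 2 (weightTwo α c) a) :
    KernelFormula α c (fun p => profit α a p 1) a := by
  refine ⟨fun R x hx => integrableOn_truncKernel_mul_profit hα hc ha R hx, ?_⟩
  have hmp := PiLp.volume_preserving_ofLp (Fin n)
  have hf : Integrable (euclideanDensity α c a) :=
    hmp.integrable_comp_of_integrable (integrable_logDensity ha).ofReal
  have hf₂ : MemLp (euclideanDensity α c a) 2 :=
    (memLp_logDensity ha ha₂).ofReal.comp_measurePreserving hmp
  have hρ : 0 < α / (2 * Real.pi) := by positivity
  -- The radius `R` in `τ` is `α R / (2π)` in the Fourier variable, and the norm is squared.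
  have h := ((tendsto_eLpNorm_fourierInv_indicator_fourier_sub hf hf₂).comp
    (tendsto_id.const_mul_atTop hρ)).ennrpow_const 2
  simp only [ENNReal.zero_rpow_of_pos (zero_lt_two' ℝ)] at h
  refine h.congr fun R => ?_
  rw [Function.comp_apply, id, eLpNorm_eq_lintegral_rpow_enorm_toReal (by norm_num) (by norm_num),
    ← ENNReal.rpow_mul, ENNReal.toReal_ofNat, one_div_mul_cancel (by norm_num), ENNReal.rpow_one,
    lintegral_weightTwo, ← hmp.lintegral_comp_emb
      (MeasurableEquiv.toLp 2 (Fin n → ℝ)).symm.measurableEmbedding]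
  congr 1 with v
  rw [Pi.sub_apply, ← truncInverse_profit_expVec hα hc ha, euclideanDensity, logDensity,
    Complex.ofReal_mul, ← mul_sub, enorm_mul, ENNReal.rpow_ofNat]
  congr 2
  rw [← ofReal_norm, Complex.norm_of_nonneg (Real.exp_pos _).le]

theorem KernelFormula.congr {α : ℝ} {c : Fin n → ℝ} {g g' a : (Fin n → ℝ) → ℝ}
    (h : KernelFormula α c g a) (hg : g =ᵐ[volume.restrict (orthant n)] g') :
    KernelFormula α c g' a := by
  have hT : ∀ R x, truncInverse α c R g x = truncInverse α c R g' x := fun R x =>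
    integral_congr_ae (by filter_upwards [hg] with p hp; rw [hp])
  refine ⟨fun R x hx => (h.1 R x hx).congr ?_, ?_⟩
  · filter_upwards [hg] with p hp
    rw [hp]
  · simpa only [hT] using h.2

end InversionFormula

end CESRadon

namespace CESRadon

/-! ### Distributional derivatives on the half-line -/

section HalfLine

/-- Integration by parts for a merely integrable `r`: Fubini on `{s ≤ t}`, with `∫ φ'` over `[s, ∞)`
equal to `-φ(s)`. -/
theorem integral_deriv_mul_integral_Iic {r φ : ℝ → ℝ} (hr : ∀ T, IntegrableOn r (Set.Iic T))
    (hφ : ContDiff ℝ 1 φ) (hφc : HasCompactSupport φ) :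
    ∫ t, deriv φ t * ∫ s in Set.Iic t, r s = -∫ s, φ s * r s := by
  obtain ⟨T, hT⟩ := hφc.isCompact.bddAbove
  have hφ0 : ∀ t, T < t → φ t = 0 := fun t ht =>
    image_eq_zero_of_notMem_tsupport fun h => not_le.2 ht (hT h)
  have hd0 : ∀ t, T < t → deriv φ t = 0 := fun t ht =>
    image_eq_zero_of_notMem_tsupport fun h => not_le.2 ht (hT (tsupport_deriv_subset h))
  have hdc : Continuous (deriv φ) := hφ.continuous_deriv le_rfl
  have hdi : Integrable (deriv φ) := hdc.integrable_of_hasCompactSupport hφc.deriv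
  -- Cutting `r` off at `T` makes it integrable on the line and loses nothing, since `φ` vanishes
  -- beyond `T`.
  have hr1 : Integrable ((Set.Iic T).indicator r) := (hr T).integrable_indicator measurableSet_Iic
  have hms : MeasurableSet {z : ℝ × ℝ | z.2 ≤ z.1} := measurableSet_le measurable_snd measurable_fst
  have hint : Integrable (Function.uncurry fun t s : ℝ =>
      {z : ℝ × ℝ | z.2 ≤ z.1}.indicator
        (fun z => deriv φ z.1 * (Set.Iic T).indicator r z.2) (t, s)) (volume.prod volume) :=
    (hdi.mul_prod hr1).indicator hms
  have h := integral_integral_swap hint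
  have h1 : ∀ t, ∫ s, {z : ℝ × ℝ | z.2 ≤ z.1}.indicator
      (fun z => deriv φ z.1 * (Set.Iic T).indicator r z.2) (t, s) =
      deriv φ t * ∫ s in Set.Iic t, r s := by
    intro t
    rcases le_or_gt t T with ht | ht
    · rw [← integral_indicator measurableSet_Iic, ← integral_const_mul]
      congr 1 with s
      by_cases hs : s ≤ t
      · simp [Set.indicator, hs, hs.trans ht]
      · simp [Set.indicator, hs]
    · rw [hd0 t ht]
      simp [Set.indicator, hd0 t ht]
  have h2 : ∀ s, ∫ t, {z : ℝ × ℝ | z.2 ≤ z.1}.indicator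
      (fun z => deriv φ z.1 * (Set.Iic T).indicator r z.2) (t, s) = -(φ s * r s) := by
    intro s
    have e : (fun t => {z : ℝ × ℝ | z.2 ≤ z.1}.indicator
        (fun z => deriv φ z.1 * (Set.Iic T).indicator r z.2) (t, s)) =
        (Set.Ici s).indicator fun t => deriv φ t * (Set.Iic T).indicator r s := by
      funext t
      simp [Set.indicator]
    rw [e, integral_indicator measurableSet_Ici, integral_mul_const, integral_Ici_eq_integral_Ioi,
      hφc.integral_Ioi_deriv_eq hφ]
    rcases le_or_gt s T with hs | hs
    · simp [Set.indicator, hs]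
    · simp [hφ0 s hs]
  simp only [h1, h2] at h
  rw [h, integral_neg]

theorem continuous_integral_Iic {r : ℝ → ℝ} (hr : ∀ T, IntegrableOn r (Set.Iic T)) :
    Continuous fun t => ∫ s in Set.Iic t, r s := by
  have e : (fun t => ∫ s in Set.Iic t, r s) =
      fun t => (∫ s in (0 : ℝ)..t, r s) + ∫ s in Set.Iic (0 : ℝ), r s := by
    funext t
    rw [← intervalIntegral.integral_Iic_sub_Iic (hr 0) (hr t), sub_add_cancel]
  rw [e]
  refine (intervalIntegral.continuous_primitive (fun a b => ?_) 0).add continuous_const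
  exact ⟨(hr b).mono_set Set.Ioc_subset_Iic_self, (hr a).mono_set Set.Ioc_subset_Iic_self⟩

theorem locallyIntegrable_of_integrableOn_Iic {r : ℝ → ℝ} (hr : ∀ T, IntegrableOn r (Set.Iic T)) :
    LocallyIntegrable r := fun x => ⟨Set.Iic (x + 1), Iic_mem_nhds (by linarith), hr _⟩

theorem regularDistribution_apply {f : ℝ → ℝ} (hf : LocallyIntegrableOn f (Set.Ioi 0))
    (φ : 𝓓(halfLine, ℝ)) : regularDistribution f φ = ∫ t, φ t * f t :=
  TestFunction.integralAgainstBilinCLM_eq_integral hf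

/-- The distributional derivative of a primitive of `r` is `r`. -/
theorem isGivenBy_lineDeriv_primitive {r : ℝ → ℝ} (hr : ∀ T, IntegrableOn r (Set.Iic T)) :
    IsGivenBy (∂_{(1 : ℝ)} (regularDistribution fun t => ∫ s in Set.Iic t, r s)) r := by
  have hl : LocallyIntegrableOn r (Set.Ioi 0) :=
    (locallyIntegrable_of_integrableOn_Iic hr).locallyIntegrableOn _
  refine ⟨hl, ?_⟩
  ext φ
  rw [Distribution.lineDerivOp_apply_apply, map_neg, regularDistribution_apply hl,
    regularDistribution_apply
      ((continuous_integral_Iic hr).locallyIntegrable.locallyIntegrableOn _),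
    eq_comm, neg_eq_iff_eq_neg, ← integral_deriv_mul_integral_Iic hr
      (φ.contDiff.of_le (by exact_mod_cast le_top)) φ.hasCompactSupport]
  congr 1 with t

/-- The fundamental lemma of the calculus of variations. Any function representing the Radon
transform can be replaced by the density constructed below. -/
theorem IsGivenBy.ae_eq {T : 𝓓'(halfLine, ℝ)} {r r' : ℝ → ℝ} (h : IsGivenBy T r)
    (h' : IsGivenBy T r') : r =ᵐ[volume.restrict (Set.Ioi 0)] r' := by
  have key := isOpen_Ioi.ae_eq_zero_of_integral_contDiff_smul_eq_zero (μ := volume)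
    (h.1.sub h'.1) (by
    intro g hg hgc hgs
    let φ : 𝓓(halfLine, ℝ) := ⟨g, hg, hgc, hgs⟩
    have hφ : ∀ t, φ t = g t := fun _ => rfl
    have e := congrArg (fun S => S φ) (h.2.trans h'.2.symm)
    simp only [regularDistribution_apply h.1, regularDistribution_apply h'.1, hφ] at e
    have hi : ∀ {u : ℝ → ℝ}, LocallyIntegrableOn u (Set.Ioi 0) → Integrable fun t => g t * u t := by
      intro u hu
      exact TestFunction.integrable_bilin (ContinuousLinearMap.mul ℝ ℝ) hu φ
    simp only [Pi.sub_apply, smul_eq_mul, mul_sub]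
    rw [integral_sub (hi h.1) (hi h'.1), e, sub_self])
  rw [EventuallyEq, ae_restrict_iff' measurableSet_Ioi]
  filter_upwards [key] with t ht hpos
  simpa [sub_eq_zero] using ht hpos

end HalfLine

end CESRadon

namespace CESRadon

/-! ### Sublevel sets of the CES function -/

section Sublevel

variable {n : ℕ}

/-- The sublevel set of the CES function. -/
def sublevel {n : ℕ} (α : ℝ) (p : Fin n → ℝ) (t : ℝ) : Set (Fin n → ℝ) :=
  {x ∈ orthant n | cesProd α p x ≤ t}

theorem measurable_cesProd (α : ℝ) (p : Fin n → ℝ) : Measurable (cesProd α p) := by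
  unfold cesProd
  fun_prop

theorem measurableSet_sublevel (α : ℝ) (p : Fin n → ℝ) (t : ℝ) :
    MeasurableSet (sublevel α p t) :=
  measurableSet_orthant.inter (measurable_cesProd α p measurableSet_Iic)

theorem sublevel_subset (α : ℝ) (p : Fin n → ℝ) (t : ℝ) : sublevel α p t ⊆ orthant n :=
  fun _ hx => hx.1

theorem sublevel_mono (α : ℝ) (p : Fin n → ℝ) {s t : ℝ} (h : s ≤ t) :
    sublevel α p s ⊆ sublevel α p t := fun _ hx => ⟨hx.1, hx.2.trans h⟩

theorem cesProd_nonneg (α : ℝ) {p x : Fin n → ℝ} (hp : p ∈ orthant n) (hx : x ∈ orthant n) :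
    0 ≤ cesProd α p x :=
  Real.rpow_nonneg (Finset.sum_nonneg fun k _ => Real.rpow_nonneg (mul_nonneg (hp k) (hx k)) _) _

theorem cesProd_pos [NeZero n] (α : ℝ) {p x : Fin n → ℝ} (hp : p ∈ posOrthant n)
    (hx : x ∈ posOrthant n) : 0 < cesProd α p x :=
  Real.rpow_pos_of_pos (Finset.sum_pos
    (fun k _ => Real.rpow_pos_of_pos (mul_pos (hp k) (hx k)) _) Finset.univ_nonempty) _

theorem mul_le_cesProd {α : ℝ} (hα : 0 < α) {p x : Fin n → ℝ} (hp : p ∈ orthant n)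
    (hx : x ∈ orthant n) (k : Fin n) : p k * x k ≤ cesProd α p x := by
  have h : (p k * x k) ^ α ≤ ∑ j, (p j * x j) ^ α :=
    Finset.single_le_sum (f := fun j => (p j * x j) ^ α)
      (fun j _ => Real.rpow_nonneg (mul_nonneg (hp j) (hx j)) _) (Finset.mem_univ k)
  have h' := Real.rpow_le_rpow (Real.rpow_nonneg (mul_nonneg (hp k) (hx k)) _) h
    (one_div_nonneg.2 hα.le)
  rwa [← Real.rpow_mul (mul_nonneg (hp k) (hx k)), mul_one_div_cancel hα.ne', Real.rpow_one] at h'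

theorem ae_mem_posOrthant : ∀ᵐ x ∂(volume.restrict (orthant n)), x ∈ posOrthant n := by
  rw [restrict_orthant]
  exact ae_restrict_mem measurableSet_posOrthant

theorem ae_mem_posOrthant_of_subset {s : Set (Fin n → ℝ)} (hs : s ⊆ orthant n) :
    ∀ᵐ x ∂(volume.restrict s), x ∈ posOrthant n :=
  ae_mono (Measure.restrict_mono hs le_rfl) ae_mem_posOrthant

/-- On the sublevel set `xₖ ≤ t / pₖ`, and `α (1 - cₖ) > 0`, so the reciprocal of the weight is
bounded there. -/
theorem integrableOn_sublevel {α : ℝ} (hα : 0 < α) {c : Fin n → ℝ} (hc : ∀ k, c k < 1)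
    {a : (Fin n → ℝ) → ℝ} (ha : MemWeightedL 1 (weightOne α c) a) {p : Fin n → ℝ}
    (hp : p ∈ posOrthant n) (t : ℝ) : IntegrableOn a (sublevel α p t) := by
  have hs := sublevel_subset α p t
  have hi := (integrableOn_mul_weightOne ha).mono_set hs
  refine (hi.norm.const_mul (∏ k, (t / p k) ^ (α * (1 - c k)))).mono'
    (ha.1.aestronglyMeasurable.mono_measure (Measure.restrict_mono hs le_rfl)) ?_
  filter_upwards [ae_mem_posOrthant_of_subset hs,
    ae_restrict_mem (measurableSet_sublevel α p t)] with x hx hxt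
  have h1 : 1 = (∏ k, x k ^ (α * (1 - c k))) * weightOne α c x := by
    rw [weightOne, ← Finset.prod_mul_distrib, eq_comm]
    refine Finset.prod_eq_one fun k _ => ?_
    rw [← Real.rpow_add (hx k)]
    ring_nf
    exact Real.rpow_zero _
  have h2 : ∏ k, x k ^ (α * (1 - c k)) ≤ ∏ k, (t / p k) ^ (α * (1 - c k)) := by
    refine Finset.prod_le_prod (fun k _ => Real.rpow_nonneg (hx k).le _) fun k _ => ?_
    refine Real.rpow_le_rpow (hx k).le ?_ (mul_pos hα (by linarith [hc k])).le
    rw [le_div_iff₀' (hp k)]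
    exact (mul_le_cesProd hα (posOrthant_subset hp) hxt.1 k).trans hxt.2
  have hw := weightOne_nonneg α c hxt.1
  rw [norm_mul, Real.norm_of_nonneg hw]
  calc ‖a x‖ = (∏ k, x k ^ (α * (1 - c k))) * (‖a x‖ * weightOne α c x) := by
        linear_combination ‖a x‖ * h1
    _ ≤ _ := mul_le_mul_of_nonneg_right h2 (mul_nonneg (norm_nonneg _) hw)

theorem integrableOn_max_sub_cesProd_mul {α : ℝ} (hα : 0 < α) {c : Fin n → ℝ}
    (hc : ∀ k, c k < 1) {a : (Fin n → ℝ) → ℝ} (ha : MemWeightedL 1 (weightOne α c) a)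
    {p : Fin n → ℝ} (hp : p ∈ posOrthant n) (t : ℝ) :
    IntegrableOn (fun x => max 0 (t - cesProd α p x) * a x) (orthant n) := by
  have h : IntegrableOn (fun x => max 0 (t - cesProd α p x) * a x) (sublevel α p t) := by
    refine Integrable.bdd_mul (c := |t|) (integrableOn_sublevel hα hc ha hp t)
      (measurable_const.max (measurable_const.sub (measurable_cesProd α p))).aestronglyMeasurable ?_
    filter_upwards [ae_restrict_mem (measurableSet_sublevel α p t)] with x hx
    rw [Real.norm_of_nonneg (le_max_left _ _)]
    refine max_le (abs_nonneg _) ?_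
    have := cesProd_nonneg α (posOrthant_subset hp) hx.1
    linarith [le_abs_self t]
  refine h.of_forall_sdiff_eq_zero measurableSet_orthant fun x hx => ?_
  have : t < cesProd α p x := not_le.1 fun h => hx.2 ⟨hx.1, h⟩
  rw [max_eq_left (by linarith), zero_mul]

theorem volume_sublevel_zero [NeZero n] (α : ℝ) {p : Fin n → ℝ} (hp : p ∈ posOrthant n) :
    volume (sublevel α p 0) = 0 := by
  have h : ∀ᵐ x ∂(volume.restrict (sublevel α p 0)), False := by
    filter_upwards [ae_mem_posOrthant_of_subset (sublevel_subset α p 0),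
      ae_restrict_mem (measurableSet_sublevel α p 0)] with x hx hx0
    exact not_lt.2 hx0.2 (cesProd_pos α hp hx)
  simpa using h

/-- The map `r ↦ exp (-r) * C` pulls null sets back to null sets. -/
theorem volume_preimage_exp_neg_mul {N : Set ℝ} (hN : volume N = 0) {C : ℝ} (hC : 0 < C) :
    volume {r | Real.exp (-r) * C ∈ N} = 0 := by
  have hsub : {r | Real.exp (-r) * C ∈ N} ⊆
      (fun u => Real.log C - Real.log u) '' (N ∩ Set.Ioi 0) := by
    intro r hr
    refine ⟨Real.exp (-r) * C, ⟨hr, mul_pos (Real.exp_pos _) hC⟩, ?_⟩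
    beta_reduce
    rw [Real.log_mul (Real.exp_pos _).ne' hC.ne', Real.log_exp]
    ring
  refine measure_mono_null hsub (addHaar_image_eq_zero_of_differentiableOn_of_addHaar_eq_zero _
    (fun u hu => ?_) (measure_mono_null Set.inter_subset_left hN))
  exact ((differentiableAt_const _).sub
    (Real.differentiableAt_log (Set.mem_Ioi.1 hu.2).ne')).differentiableWithinAt

/-- For fixed `t` the dilates `exp (-r) * ‖t‖` meet `N` only for a null set of `r`. By Fubini some
single `r` is good for almost every `t`, and translation by `r` undoes the dilation. -/
theorem ae_cesExp_notMem [NeZero n] {α : ℝ} (hα : α ≠ 0) {N : Set ℝ} (hNm : MeasurableSet N)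
    (hN : volume N = 0) : ∀ᵐ t : Fin n → ℝ, cesExp α t ∉ N := by
  have hm : MeasurableSet {z : ℝ × (Fin n → ℝ) | Real.exp (-z.1) * cesExp α z.2 ∉ N} := by
    have hc := continuous_cesExp (n := n) α
    have : Measurable fun z : ℝ × (Fin n → ℝ) => Real.exp (-z.1) * cesExp α z.2 :=
      (by fun_prop : Continuous _).measurable
    exact this hNm.compl
  have h : ∀ᵐ t : Fin n → ℝ, ∀ᵐ r : ℝ, Real.exp (-r) * cesExp α t ∉ N :=
    Eventually.of_forall fun t => by
      rw [ae_iff]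
      simpa using volume_preimage_exp_neg_mul hN (cesExp_pos α t)
  obtain ⟨r, hr⟩ := ((Measure.ae_ae_comm hm).2 h).exists
  have hr' : ∀ᵐ t : Fin n → ℝ, cesExp α (t - fun _ => r) ∉ N := by
    simpa only [cesExp_sub_const hα] using hr
  have := (measurePreserving_add_right (volume : Measure (Fin n → ℝ))
    fun _ => r).quasiMeasurePreserving.ae hr'
  simpa using this

/-- The CES function pulls null sets back to null sets. -/
theorem absolutelyContinuous_map_cesProd [NeZero n] {α : ℝ} (hα : α ≠ 0) {p : Fin n → ℝ}
    (hp : p ∈ posOrthant n) :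
    (volume.restrict (orthant n)).map (cesProd α p) ≪ volume := by
  obtain ⟨s, rfl⟩ := exists_expVec_eq hp
  refine Measure.AbsolutelyContinuous.mk fun N hNm hN => ?_
  rw [Measure.map_apply (measurable_cesProd α _) hNm, ← lintegral_indicator_one
    (measurable_cesProd α _ hNm), lintegral_orthant, lintegral_eq_zero_iff' ?_]
  · have h := ae_cesExp_notMem (n := n) hα hNm hN
    have h' := (measurePreserving_add_left (volume : Measure (Fin n → ℝ))
      s).quasiMeasurePreserving.ae h
    filter_upwards [h'] with t ht
    rw [Set.indicator_of_notMem, mul_zero, Pi.zero_apply]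
    rwa [Set.mem_preimage, cesProd_expVec]
  · have h1 : Measurable fun t : Fin n → ℝ => ENNReal.ofReal (Real.exp (∑ k, t k)) := by fun_prop
    exact (h1.mul ((measurable_one.indicator (measurable_cesProd α _ hNm)).comp
      continuous_expVec.measurable)).aemeasurable

end Sublevel

/-! ### The Radon transform as a density and its link to the profit -/

section RadonDensity

variable {n : ℕ}

/-- The density is the Radon–Nikodym derivative of the image of the measure `b dx` under `x ↦ p ⊙
x`. -/
theorem exists_density_of_nonneg [NeZero n] {α : ℝ} (hα : α ≠ 0) {p : Fin n → ℝ}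
    (hp : p ∈ posOrthant n) {b : (Fin n → ℝ) → ℝ} (hb : ∀ t, IntegrableOn b (sublevel α p t))
    (hb0 : ∀ x, 0 ≤ b x) :
    ∃ r : ℝ → ℝ, ∀ t, IntegrableOn r (Set.Iic t) ∧
      ∫ s in Set.Iic t, r s = ∫ x in sublevel α p t, b x := by
  set μ := (volume.restrict (orthant n)).withDensity fun x => ENNReal.ofReal (b x) with hμ
  have hσ : SigmaFinite μ := SigmaFinite.withDensity_ofReal b
  set ν := μ.map (cesProd α p) with hν
  have hac : ν ≪ volume := ((withDensity_absolutelyContinuous _ _).map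
    (measurable_cesProd α p)).trans (absolutelyContinuous_map_cesProd hα hp)
  have hd : volume.withDensity (ν.rnDeriv volume) = ν := Measure.withDensity_rnDeriv_eq ν volume hac
  have hI : ∀ t, ∫⁻ s in Set.Iic t, ν.rnDeriv volume s =
      ∫⁻ x in sublevel α p t, ENNReal.ofReal (b x) := by
    intro t
    rw [← withDensity_apply _ measurableSet_Iic, hd, hν,
      Measure.map_apply (measurable_cesProd α p) measurableSet_Iic, hμ,
      withDensity_apply _ (measurable_cesProd α p measurableSet_Iic),
      Measure.restrict_restrict (measurable_cesProd α p measurableSet_Iic), Set.inter_comm]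
    rfl
  have hfin : ∀ t, ∫⁻ x in sublevel α p t, ENNReal.ofReal (b x) ≠ ⊤ := fun t =>
    ((lintegral_ofReal_le_lintegral_enorm _).trans_lt (hb t).2).ne
  have hm : Measurable (ν.rnDeriv volume) := Measure.measurable_rnDeriv _ _
  refine ⟨fun s => (ν.rnDeriv volume s).toReal, fun t => ⟨?_, ?_⟩⟩
  · exact integrable_toReal_of_lintegral_ne_top hm.aemeasurable ((hI t).trans_ne (hfin t))
  · rw [integral_toReal hm.aemeasurable (ae_lt_top hm ((hI t).trans_ne (hfin t))), hI,
      integral_eq_lintegral_of_nonneg_ae (Eventually.of_forall hb0) (hb t).1]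

/-- The integrals over the sublevel sets of the CES function are absolutely continuous. -/
theorem exists_density [NeZero n] {α : ℝ} (hα : α ≠ 0) {p : Fin n → ℝ}
    (hp : p ∈ posOrthant n) {a : (Fin n → ℝ) → ℝ} (ha : ∀ t, IntegrableOn a (sublevel α p t)) :
    ∃ r : ℝ → ℝ, ∀ t, IntegrableOn r (Set.Iic t) ∧
      ∫ s in Set.Iic t, r s = ∫ x in sublevel α p t, a x := by
  obtain ⟨r₁, h₁⟩ := exists_density_of_nonneg hα hp (fun t => (ha t).pos_part)
    fun x => le_max_right _ _
  obtain ⟨r₂, h₂⟩ := exists_density_of_nonneg hα hp (fun t => (ha t).neg_part)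
    fun x => le_max_right _ _
  refine ⟨r₁ - r₂, fun t => ⟨(h₁ t).1.sub (h₂ t).1, ?_⟩⟩
  simp only [Pi.sub_apply]
  rw [integral_sub (h₁ t).1 (h₂ t).1, (h₁ t).2, (h₂ t).2,
    ← integral_sub (ha t).pos_part (ha t).neg_part]
  congr 1 with x
  simp

theorem isGivenBy_radon {α : ℝ} {p : Fin n → ℝ} {a : (Fin n → ℝ) → ℝ} {r : ℝ → ℝ}
    (hr : ∀ t, IntegrableOn r (Set.Iic t) ∧ ∫ s in Set.Iic t, r s = ∫ x in sublevel α p t, a x) :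
    IsGivenBy (radon α a p) r := by
  have h := isGivenBy_lineDeriv_primitive fun t => (hr t).1
  simp only [(hr _).2] at h
  exact h

/-- The profit is the integral of the mass of the sublevel sets. -/
theorem integral_integral_sublevel {α : ℝ} {p : Fin n → ℝ} (hp : p ∈ posOrthant n)
    {a : (Fin n → ℝ) → ℝ} (ha : IntegrableOn a (sublevel α p 1)) :
    ∫ t in (0 : ℝ)..1, ∫ x in sublevel α p t, a x = profit α a p 1 := by
  have hms : MeasurableSet {z : ℝ × (Fin n → ℝ) | cesProd α p z.2 ≤ z.1} :=
    measurableSet_le ((measurable_cesProd α p).comp measurable_snd) measurable_fst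
  have hone : Integrable (fun _ : ℝ => (1 : ℝ)) (volume.restrict (Set.Ioc 0 1)) :=
    integrable_const _
  have hint : Integrable (Function.uncurry fun (t : ℝ) (x : Fin n → ℝ) =>
      {z : ℝ × (Fin n → ℝ) | cesProd α p z.2 ≤ z.1}.indicator (fun z => 1 * a z.2) (t, x))
      ((volume.restrict (Set.Ioc 0 1)).prod (volume.restrict (sublevel α p 1))) :=
    (hone.mul_prod ha).indicator hms
  have h := integral_integral_swap hint
  have h1 : ∀ t ∈ Set.Ioc (0 : ℝ) 1, ∫ x in sublevel α p 1,
      {z : ℝ × (Fin n → ℝ) | cesProd α p z.2 ≤ z.1}.indicator (fun z => 1 * a z.2) (t, x) =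
      ∫ x in sublevel α p t, a x := by
    intro t ht
    have e : sublevel α p t = sublevel α p 1 ∩ {x | cesProd α p x ≤ t} := by
      ext x
      exact ⟨fun h => ⟨sublevel_mono α p ht.2 h, h.2⟩, fun h => ⟨h.1.1, h.2⟩⟩
    rw [e, ← setIntegral_indicator (measurableSet_le (measurable_cesProd α p) measurable_const)]
    congr 1 with x
    simp [Set.indicator]
  have h2 : ∀ x ∈ sublevel α p 1, ∫ t in Set.Ioc (0 : ℝ) 1,
      {z : ℝ × (Fin n → ℝ) | cesProd α p z.2 ≤ z.1}.indicator (fun z => 1 * a z.2) (t, x) =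
      max 0 (1 - cesProd α p x) * a x := by
    intro x hx
    have hx0 := cesProd_nonneg α (posOrthant_subset hp) hx.1
    have e : (fun t => {z : ℝ × (Fin n → ℝ) | cesProd α p z.2 ≤ z.1}.indicator
        (fun z => 1 * a z.2) (t, x)) = (Set.Ici (cesProd α p x)).indicator fun _ => a x := by
      funext t
      simp [Set.indicator]
    -- The two sets can differ only at the point `0`, when `p ⊙ x = 0`.
    have e' : (Set.Ioc 0 1 ∩ Set.Ici (cesProd α p x) : Set ℝ) =ᵐ[volume]
        Set.Icc (cesProd α p x) 1 := by
      have := Ioc_ae_eq_Icc (μ := volume) (a := (0 : ℝ)) (b := 1)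
      refine (this.inter (ae_eq_refl (Set.Ici (cesProd α p x)))).trans
        (Eventually.of_forall fun t => ?_)
      exact propext ⟨fun h => ⟨h.2, h.1.2⟩, fun h => ⟨⟨hx0.trans h.1, h.2⟩, h.1⟩⟩
    rw [e, setIntegral_indicator measurableSet_Ici, setIntegral_congr_set e', setIntegral_const,
      Real.volume_real_Icc, smul_eq_mul, max_comm]
  rw [intervalIntegral.integral_of_le zero_le_one, ← setIntegral_congr_fun measurableSet_Ioc h1, h,
    setIntegral_congr_fun (measurableSet_sublevel α p 1) h2, profit]
  refine (setIntegral_eq_of_subset_of_forall_sdiff_eq_zero measurableSet_orthant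
    (sublevel_subset α p 1) fun x hx => ?_).symm
  have : 1 < cesProd α p x := not_le.1 fun h => hx.2 ⟨hx.1, h⟩
  rw [max_eq_left (by linarith), zero_mul]

/-- Twofold integration of the Radon transform gives the profit transform. -/
theorem integrableOn_and_integral_of_isGivenBy_radon [NeZero n] {α : ℝ} (hα : α ≠ 0)
    {p : Fin n → ℝ} (hp : p ∈ posOrthant n) {a : (Fin n → ℝ) → ℝ}
    (ha : ∀ t, IntegrableOn a (sublevel α p t)) {r : ℝ → ℝ} (hr : IsGivenBy (radon α a p) r) :
    IntegrableOn r (Set.Ioc 0 1) ∧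
      ∫ t in (0 : ℝ)..1, ∫ s in (0 : ℝ)..t, r s = profit α a p 1 := by
  obtain ⟨r₀, h₀⟩ := exists_density hα hp ha
  have hae : r₀ =ᵐ[volume.restrict (Set.Ioi 0)] r := (isGivenBy_radon h₀).ae_eq hr
  have hae' : ∀ t, r₀ =ᵐ[volume.restrict (Set.Ioc 0 t)] r := fun t =>
    ae_mono (Measure.restrict_mono Set.Ioc_subset_Ioi_self le_rfl) hae
  refine ⟨((h₀ 1).1.mono_set Set.Ioc_subset_Iic_self).congr (hae' 1), ?_⟩
  rw [← integral_integral_sublevel hp (ha 1)]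
  refine intervalIntegral.integral_congr fun t ht => ?_
  rw [Set.uIcc_of_le zero_le_one] at ht
  -- The integral over `(0, t]` is the mass at level `t` minus that at level `0`, which vanishes
  -- because the zero sublevel set is null.
  rw [intervalIntegral.integral_of_le ht.1, ← integral_congr_ae (hae' t),
    ← intervalIntegral.integral_of_le ht.1, ← intervalIntegral.integral_Iic_sub_Iic (h₀ 0).1
    (h₀ t).1, (h₀ 0).2, (h₀ t).2, setIntegral_measure_zero _ (volume_sublevel_zero α hp), sub_zero]

end RadonDensity

end CESRadon

theorem mainTheorem3 (n : ℕ) (hn : 1 ≤ n) (α : ℝ) (hα₀ : 0 < α) (hα₁ : α ≤ 1)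
    (c : Fin n → ℝ) (hc : ∀ k, c k < 1) (a : (Fin n → ℝ) → ℝ)
    (ha₁ : CESRadon.MemWeightedL 1 (CESRadon.weightOne α c) a)
    (ha₂ : CESRadon.MemWeightedL 2 (CESRadon.weightTwo α c) a) :
    -- the integrals defining the transforms converge absolutely
    (∀ p ∈ CESRadon.posOrthant n, ∀ p₀ : ℝ, 0 < p₀ →
      IntegrableOn a {x ∈ CESRadon.orthant n | CESRadon.cesProd α p x ≤ p₀} ∧
      IntegrableOn (fun x => max 0 (p₀ - CESRadon.cesProd α p x) * a x)
        (CESRadon.orthant n)) ∧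
    -- inversion of the profit transform
    CESRadon.KernelFormula α c (fun p => CESRadon.profit α a p 1) a ∧
    -- the Radon transform is a locally integrable function of `p₀`
    (∀ p ∈ CESRadon.posOrthant n, ∃ r : ℝ → ℝ,
      CESRadon.IsGivenBy (CESRadon.radon α a p) r) ∧
    -- inversion of the Radon transform
    (∀ r : (Fin n → ℝ) → ℝ → ℝ,
      (∀ᵐ p ∂(volume.restrict (CESRadon.orthant n)),
        CESRadon.IsGivenBy (CESRadon.radon α a p) (r p)) →
      (∀ᵐ p ∂(volume.restrict (CESRadon.orthant n)), IntegrableOn (r p) (Set.Ioc 0 1)) ∧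
      CESRadon.KernelFormula α c
        (fun p => ∫ t in (0 : ℝ)..1, ∫ s in (0 : ℝ)..t, r p s) a) := by
  have : NeZero n := ⟨(Nat.lt_of_lt_of_le Nat.zero_lt_one hn).ne'⟩
  have hS : ∀ p ∈ CESRadon.posOrthant n, ∀ t, IntegrableOn a (CESRadon.sublevel α p t) :=
    fun p hp t => CESRadon.integrableOn_sublevel hα₀ hc ha₁ hp t
  have hprofit := CESRadon.kernelFormula_profit hα₀ hc ha₁ ha₂
  refine ⟨fun p hp p₀ _ => ⟨hS p hp p₀,
    CESRadon.integrableOn_max_sub_cesProd_mul hα₀ hc ha₁ hp p₀⟩, hprofit, fun p hp => ?_,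
    fun r hr => ?_⟩
  · obtain ⟨r, hr⟩ := CESRadon.exists_density hα₀.ne' hp (hS p hp)
    exact ⟨r, CESRadon.isGivenBy_radon hr⟩
  -- For almost every `p` the iterated integral is the profit, and the kernel formula sees its
  -- argument only up to null sets.
  · have h : ∀ᵐ p ∂(volume.restrict (CESRadon.orthant n)), IntegrableOn (r p) (Set.Ioc 0 1) ∧
        ∫ t in (0 : ℝ)..1, ∫ s in (0 : ℝ)..t, r p s = CESRadon.profit α a p 1 := by
      filter_upwards [hr, CESRadon.ae_mem_posOrthant] with p hrp hp
      exact CESRadon.integrableOn_and_integral_of_isGivenBy_radon hα₀.ne' hp (hS p hp) hrp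
    exact ⟨h.mono fun p hp => hp.1, hprofit.congr (h.mono fun p hp => hp.2.symm)⟩
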